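/- \textbf{Setting.} Let $n$ clients solve $\min_{u,\mathbf v} f(u,\mathbf v)=\frac1n\sum_{i=1}^n f_i(u,v_i)$, with $f_i(u,v)=\mathbb E_{\xi\sim\mathcal D_i}[F(u,v;\xi)]$, where $u\in\mathbb R^{d_u}$, $\mathbf v=(v_1,\dots,v_n)$, $v_i\in\mathbb R^{d_v}$, each $\mathcal D_i$ is a probability distribution, and $F(u,v;\cdot)$ is $\mathcal D_i$-integrable. For all $i,u,v$ the partial gradients $\nabla_uF(u,v;\xi)$, $\nabla_vF(u,v;\xi)$ exist for $\mathcal D_i$-almost every $\xi$, and they are measurable in $(u,v,\xi)$. Assume $\inf f>-\infty$. \textbf{Assumptions.} For every $i$: (1) (Smoothness) $f_i$ is differentiable with respect to $u$ and with respect to $v$; $\nabla_uf_i(u,v)$ is $L_u$-Lipschitz in $u$ and $L_{uv}$-Lipschitz in $v$; $\nabla_vf_i(u,v)$ is $L_v$-Lipschitz in $v$ and $L_{vu}$-Lipschitz in $u$. Put $L=\max\{L_u,L_v,L_{uv},L_{vu}\}$. (2) (Stochastic gradients) For all $u,v$ and $\xi\sim\mathcal D_i$, $\mathbb E[\nabla_uF(u,v;\xi)]=\nabla_uf_i(u,v)$,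 $\mathbb E[\nabla_vF(u,v;\xi)]=\nabla_vf_i(u,v)$, $\mathbb E\|\nabla_uF(u,v;\xi)-\nabla_uf_i(u,v)\|^2\le\sigma_u^2$ and $\mathbb E\|\nabla_vF(u,v;\xi)-\nabla_vf_i(u,v)\|^2\le\sigma_v^2$. (3) (Bounded gradient dissimilarity) There is $b\ge0$ with $\frac1n\sum_{i=1}^n\|\nabla_uf_i(u,v_i)\|^2\le b^2+\|\nabla_uf(u,\mathbf v)\|^2$ for all $u,\mathbf v$. \textbf{Algorithm (FedAvg-P).} Let $1\le m\le n$, $K\ge1$, $T\ge1$, and let $(u^0,\mathbf v^0)$ be deterministic. In round $t=0,1,\dots,T-1$ draw a set $\mathcal S^t$ uniformly from the $m$-element subsets of $\{1,\dots,n\}$. Each $i\in\mathcal S^t$ sets $u_{i,0}^t=u^t$, $v_{i,0}^t=v_i^t$ and, for $k=0,\dots,K-1$, $$u_{i,k+1}^t=u_{i,k}^t-\gamma_u\nabla_uF(u_{i,k}^t,v_{i,k}^t;\xi_{i,k}^t),\qquad v_{i,k+1}^t=v_{i,k}^t-\gamma_v\nabla_vF(u_{i,k}^t,v_{i,k}^t;\xi_{i,k}^t).$$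 Then $u^{t+1}=(1-\eta_u)u^t+\frac{\eta_u}{m}\sum_{i\in\mathcal S^t}u_{i,K}^t$, and $v_i^{t+1}=(1-\eta_v)v_i^t+\eta_vv_{i,K}^t$ for $i\in\mathcal S^t$, $v_i^{t+1}=v_i^t$ for $i\notin\mathcal S^t$. Here $\xi_{i,k}^t\sim\mathcal D_i$, and all the $\xi_{i,k}^t$ and $\mathcal S^t$ are mutually independent. The step sizes satisfy $\gamma_u\eta_u=\gamma_v\eta_v=\gamma>0$. \textbf{Theorem (Convergence of FedAvg-P with partial participation).} Put $F_0=f(u^0,\mathbf v^0)-\inf f$, $\mathcal G_u^t=\mathbb E\|\nabla_uf(u^t,\mathbf v^t)\|^2$ and $\hat{\mathcal G}_{\mathbf v}^t=\frac m{n^2}\sum_{i=1}^n\mathbb E\|\nabla_vf_i(u^t,v_i^t)\|^2$. If $\eta_u\ge\sqrt m$, $\eta_v\ge\sqrt{n/m}$ and $\gamma\le\frac1{32LK}$ (that is, $32LK\gamma\le1$; no condition if $L=0$), then these expectations are finite for $t<T$ and $$\frac1T\sum_{t=0}^{T-1}\big(\mathcal G_u^t+\hat{\mathcal G}_{\mathbf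 v}^t\big)\le\frac{4F_0}{TK\gamma}+12L\Big(\frac{4(n-m)Kb^2}{mn}+\frac{\sigma_u^2}{m}+\frac{m\sigma_v^2}{n}\Big)\gamma+\frac{128L^2K(K-1)b^2}{\eta_u^2}\gamma^2 .$$ -/

import Mathlib

open MeasureTheory ProbabilityTheory
open scoped NNReal

noncomputable section

namespace FedAvgP

/-- The space of the shared variable, or of one personal variable: `ℝ^d`. -/
abbrev Vec (d : ℕ) := EuclideanSpace ℝ (Fin d)

section Objective

variable {du dv n : ℕ} {Ξ : Type*} [MeasurableSpace Ξ]

/-- Partial gradient with respect to the first variable, `∇_u g (u, v)`. -/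
def gradU (g : Vec du → Vec dv → ℝ) (u : Vec du) (v : Vec dv) : Vec du :=
  gradient (fun u' => g u' v) u

/-- Partial gradient with respect to the second variable, `∇_v g (u, v)`. -/
def gradV (g : Vec du → Vec dv → ℝ) (u : Vec du) (v : Vec dv) : Vec dv :=
  gradient (fun v' => g u v') v

/-- The loss `F (·, ·; ξ)` of one sample `ξ`, as a function of `(u, v)`. -/
def sampleLoss (F : Vec du → Vec dv → Ξ → ℝ) (ξ : Ξ) : Vec du → Vec dv → ℝ :=
  fun u v => F u v ξ

/-- The objective of client `i`: `f_i (u, v) = 𝔼_{ξ ∼ D i} F (u, v; ξ)`. -/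
def clientObj (F : Vec du → Vec dv → Ξ → ℝ) (D : Fin n → Measure Ξ) (i : Fin n) :
    Vec du → Vec dv → ℝ :=
  fun u v => ∫ ξ, F u v ξ ∂(D i)

/-- The global objective `f (u, v) = (1 / n) ∑ i, f_i (u, v_i)`. -/
def globalObj (F : Vec du → Vec dv → Ξ → ℝ) (D : Fin n → Measure Ξ)
    (u : Vec du) (v : Fin n → Vec dv) : ℝ :=
  (1 / (n : ℝ)) * ∑ i, clientObj F D i u (v i)

/-- `∇_u f (u, v)` for the global objective. -/
def globalGradU (F : Vec du → Vec dv → Ξ → ℝ) (D : Fin n → Measure Ξ)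
    (u : Vec du) (v : Fin n → Vec dv) : Vec du :=
  gradient (fun u' => globalObj F D u' v) u

/-- The initial gap `F₀ = f (u⁰, v⁰) - inf f`. -/
def initialGap (F : Vec du → Vec dv → Ξ → ℝ) (D : Fin n → Measure Ξ)
    (u₀ : Vec du) (v₀ : Fin n → Vec dv) : ℝ :=
  globalObj F D u₀ v₀ - ⨅ p : Vec du × (Fin n → Vec dv), globalObj F D p.1 p.2

/-- Standing regularity that gives a meaning to `f_i` and to the stochastic gradients
`∇_u F (u, v; ξ)`, `∇_v F (u, v; ξ)`: the losses are integrable, at every point almost every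
sample loss is differentiable, and the stochastic gradients are jointly measurable. -/
structure RegularLoss (F : Vec du → Vec dv → Ξ → ℝ) (D : Fin n → Measure Ξ) : Prop where
  integrable : ∀ i u v, Integrable (F u v) (D i)
  differentiable_u : ∀ i u v, ∀ᵐ ξ ∂(D i), DifferentiableAt ℝ (fun u' => F u' v ξ) u
  differentiable_v : ∀ i u v, ∀ᵐ ξ ∂(D i), DifferentiableAt ℝ (fun v' => F u v' ξ) v
  measurable_gradU :
    Measurable fun p : Vec du × Vec dv × Ξ => gradU (sampleLoss F p.2.2) p.1 p.2.1
  measurable_gradV :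
    Measurable fun p : Vec du × Vec dv × Ξ => gradV (sampleLoss F p.2.2) p.1 p.2.1

/-- Smoothness: every `f_i` is differentiable in `u` and in `v`, with block-wise Lipschitz
partial gradients. -/
structure Smooth (F : Vec du → Vec dv → Ξ → ℝ) (D : Fin n → Measure Ξ)
    (Lu Lv Luv Lvu : ℝ≥0) : Prop where
  differentiable_u : ∀ i v, Differentiable ℝ fun u => clientObj F D i u v
  differentiable_v : ∀ i u, Differentiable ℝ fun v => clientObj F D i u v
  lipschitz_gradU_u : ∀ i v, LipschitzWith Lu fun u => gradU (clientObj F D i) u v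
  lipschitz_gradU_v : ∀ i u, LipschitzWith Luv fun v => gradU (clientObj F D i) u v
  lipschitz_gradV_v : ∀ i u, LipschitzWith Lv fun v => gradV (clientObj F D i) u v
  lipschitz_gradV_u : ∀ i v, LipschitzWith Lvu fun u => gradV (clientObj F D i) u v

/-- Stochastic gradients are unbiased, with variances bounded by `σu ^ 2` and `σv ^ 2`. The
integrability fields say that the expectations in question are finite. -/
structure StochasticGradient (F : Vec du → Vec dv → Ξ → ℝ) (D : Fin n → Measure Ξ)
    (σu σv : ℝ) : Prop where
  integrable_u : ∀ i u v, Integrable (fun ξ => gradU (sampleLoss F ξ) u v) (D i)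
  integrable_v : ∀ i u v, Integrable (fun ξ => gradV (sampleLoss F ξ) u v) (D i)
  unbiased_u : ∀ i u v,
    ∫ ξ, gradU (sampleLoss F ξ) u v ∂(D i) = gradU (clientObj F D i) u v
  unbiased_v : ∀ i u v,
    ∫ ξ, gradV (sampleLoss F ξ) u v ∂(D i) = gradV (clientObj F D i) u v
  integrable_sq_u : ∀ i u v, Integrable
    (fun ξ => ‖gradU (sampleLoss F ξ) u v - gradU (clientObj F D i) u v‖ ^ 2) (D i)
  integrable_sq_v : ∀ i u v, Integrable
    (fun ξ => ‖gradV (sampleLoss F ξ) u v - gradV (clientObj F D i) u v‖ ^ 2) (D i)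
  variance_u : ∀ i u v,
    ∫ ξ, ‖gradU (sampleLoss F ξ) u v - gradU (clientObj F D i) u v‖ ^ 2 ∂(D i) ≤ σu ^ 2
  variance_v : ∀ i u v,
    ∫ ξ, ‖gradV (sampleLoss F ξ) u v - gradV (clientObj F D i) u v‖ ^ 2 ∂(D i) ≤ σv ^ 2

/-- Bounded gradient dissimilarity with constant `b ^ 2`. -/
def BoundedDissimilarity (F : Vec du → Vec dv → Ξ → ℝ) (D : Fin n → Measure Ξ)
    (b : ℝ) : Prop :=
  ∀ (u : Vec du) (v : Fin n → Vec dv),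
    (1 / (n : ℝ)) * ∑ i, ‖gradU (clientObj F D i) u (v i)‖ ^ 2
      ≤ b ^ 2 + ‖globalGradU F D u v‖ ^ 2

end Objective

section Algorithm

variable {du dv n : ℕ} {Ξ : Type*}

/-- The local iterates `(u_{i,k}, v_{i,k})` of one client within one round, started at `(u, v)`
and driven by the samples `ξ 0, ξ 1, …`; both blocks are updated simultaneously. -/
def localIter (F : Vec du → Vec dv → Ξ → ℝ) (γu γv : ℝ) (ξ : ℕ → Ξ)
    (u : Vec du) (v : Vec dv) : ℕ → Vec du × Vec dv
  | 0 => (u, v)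
  | k + 1 =>
    let p := localIter F γu γv ξ u v k
    (p.1 - γu • gradU (sampleLoss F (ξ k)) p.1 p.2,
      p.2 - γv • gradV (sampleLoss F (ξ k)) p.1 p.2)

/-- One round of FedAvg-P with `K` local steps and set `S` of sampled clients (of size `m`). -/
def fedRound (F : Vec du → Vec dv → Ξ → ℝ) (γu γv ηu ηv : ℝ) (m K : ℕ)
    (S : Finset (Fin n)) (ξ : Fin n → ℕ → Ξ)
    (x : Vec du × (Fin n → Vec dv)) : Vec du × (Fin n → Vec dv) :=
  ((1 - ηu) • x.1 + (ηu / (m : ℝ)) • ∑ i ∈ S, (localIter F γu γv (ξ i) x.1 (x.2 i) K).1,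
    fun i =>
      if i ∈ S then
        (1 - ηv) • x.2 i + ηv • (localIter F γu γv (ξ i) x.1 (x.2 i) K).2
      else x.2 i)

/-- The iterates `(u^t, v^t)` of FedAvg-P, for sampled client sets `S t` and samples `ξ t i k`. -/
def iter (F : Vec du → Vec dv → Ξ → ℝ) (γu γv ηu ηv : ℝ) (m K : ℕ)
    (u₀ : Vec du) (v₀ : Fin n → Vec dv)
    (S : ℕ → Finset (Fin n)) (ξ : ℕ → Fin n → ℕ → Ξ) : ℕ → Vec du × (Fin n → Vec dv)
  | 0 => (u₀, v₀)
  | t + 1 => fedRound F γu γv ηu ηv m K (S t) (ξ t) (iter F γu γv ηu ηv m K u₀ v₀ S ξ t)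

/-- The randomness of the algorithm: the samples `ξ t i k ∼ D i` and the client sets `S t`,
uniform on the `m`-element subsets of the clients, are all mutually independent. -/
structure Randomness {Ω : Type*} [MeasurableSpace Ω] [MeasurableSpace Ξ] (P : Measure Ω)
    (D : Fin n → Measure Ξ) (m : ℕ)
    (S : ℕ → Ω → Finset (Fin n)) (ξ : ℕ → Fin n → ℕ → Ω → Ξ) : Prop where
  measurable_sample : ∀ t i k, Measurable (ξ t i k)
  law_sample : ∀ t i k, P.map (ξ t i k) = D i
  measurable_clients : ∀ t, Measurable (S t)
  uniform_clients : ∀ t (A : Finset (Fin n)), A.card = m →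
    P {ω | S t ω = A} = ((n.choose m : ℕ) : ENNReal)⁻¹
  indep_samples :
    iIndepFun (fun (p : ℕ × Fin n × ℕ) => ξ p.1 p.2.1 p.2.2) P
  indep_clients : iIndepFun S P
  indep_samples_clients :
    IndepFun (fun ω (p : ℕ × Fin n × ℕ) => ξ p.1 p.2.1 p.2.2 ω) (fun ω t => S t ω) P

end Algorithm

section Stationarity

variable {du dv n : ℕ} {Ξ Ω : Type*} [MeasurableSpace Ξ] [MeasurableSpace Ω]

/-- `𝒢_u = 𝔼 ‖∇_u f (u, v)‖²` at a random point `x = (u, v)`. -/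
def expGradU (F : Vec du → Vec dv → Ξ → ℝ) (D : Fin n → Measure Ξ) (P : Measure Ω)
    (x : Ω → Vec du × (Fin n → Vec dv)) : ℝ :=
  ∫ ω, ‖globalGradU F D (x ω).1 (x ω).2‖ ^ 2 ∂P

/-- `𝒢̂_v = (m / n²) ∑ i, 𝔼 ‖∇_v f_i (u, v_i)‖²` at a random point `x = (u, v)`. -/
def expGradV (F : Vec du → Vec dv → Ξ → ℝ) (D : Fin n → Measure Ξ) (P : Measure Ω) (m : ℕ)
    (x : Ω → Vec du × (Fin n → Vec dv)) : ℝ :=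
  ((m : ℝ) / (n : ℝ) ^ 2) *
    ∑ i, ∫ ω, ‖gradV (clientObj F D i) (x ω).1 ((x ω).2 i)‖ ^ 2 ∂P

end Stationarity

end FedAvgP

end

open FedAvgP

namespace FedAvgP

open scoped RealInnerProductSpace

/-! ### Smoothness: second-order expansion in two blocks -/

section Smoothness

variable {E : Type*} [NormedAddCommGroup E] [InnerProductSpace ℝ E] [CompleteSpace E]

/-! A round is studied for a fixed participant set `A`, with every client imagined to run its `K`
local steps whether drawn or not. The draw is averaged afterwards: it is independent of all samples
and of the past, so `integral_comp_subset` replaces the expectation by the mean over all `m`-element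
sets.

For fixed `A`, blockwise smoothness (`BlockSmooth.abs_sub_le`, `globalObj_le`) bounds the new
objective by the old one plus a linear and a quadratic term in the displacement. The displacement is
a sum of exact gradients along the local paths plus a sum of oracle errors, separated by
`inner_add_norm_sq_le_roundTerm`. The errors are centred given the start of the round and pairwise
orthogonal, so their linear part has mean zero and their squares add up; this gives the terms `σu ^
2 / m` and `m * σv ^ 2 / n`.

The exact gradients sum to `K` times the gradient at the start of the round, up to the client drift.
Polarization (`neg_inner_le`) extracts a descent of `γ K / 2` times the squared gradient and leaves
a second negative square, which absorbs the quadratic term because `L K γ` is small. Sampling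
clients adds a variance with factor `(n - m) / (m n)`, controlled by the dissimilarity `b`
(`subsetAvg_norm_sum_sq_le`, `sum_norm_sub_mean_sq_le`).

The drift satisfies an inequality in which it also appears on the right with a small factor
(`sum_integral_localDist_le`). It is governed by the local steps `γ / ηu` and `γ / ηv`. The
conditions `ηu ^ 2 ≥ m` and `ηv ^ 2 ≥ n / m` make its noise comparable to the two variance terms
above and give its personal gradients the weight `m / n ^ 2` of the descent term. Half of the
descent pays for the gradient part of the drift (`round_scalar_le`), and the rest telescopes over
the rounds. -/

theorem sub_sub_inner_gradient_le {g : E → ℝ} {M : ℝ} (hg : Differentiable ℝ g)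
    (hl : ∀ x y, ‖gradient g y - gradient g x‖ ≤ M * ‖y - x‖) (x y : E) :
    g y - g x - ⟪gradient g x, y - x⟫ ≤ M / 2 * ‖y - x‖ ^ 2 := by
  set d := y - x with hd
  -- Along the segment, the first-order remainder minus its claimed bound has nonpositive derivative
  -- by Cauchy–Schwarz and the Lipschitz condition. Comparing its values at `0` and `1` gives the
  -- claim.
  have hder : ∀ s : ℝ, HasDerivAt
      (fun s : ℝ => g (x + s • d) - s * ⟪gradient g x, d⟫ - M / 2 * s ^ 2 * ‖d‖ ^ 2)
      (⟪gradient g (x + s • d), d⟫ - ⟪gradient g x, d⟫ - M * s * ‖d‖ ^ 2) s := by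
    intro s
    have h1 : HasDerivAt (fun s : ℝ => x + s • d) d s := by
      simpa using ((hasDerivAt_id s).smul_const d).const_add x
    have h2 : HasDerivAt (fun s : ℝ => g (x + s • d)) ⟪gradient g (x + s • d), d⟫ s := by
      have := (hg (x + s • d)).hasGradientAt.hasFDerivAt.comp_hasDerivAt s h1
      rwa [InnerProductSpace.toDual_apply_apply] at this
    have h3 := (h2.sub ((hasDerivAt_id s).mul_const ⟪gradient g x, d⟫)).sub
      ((((hasDerivAt_id s).pow 2).const_mul (M / 2)).mul_const (‖d‖ ^ 2))
    refine h3.congr_deriv ?_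
    simp only [id_eq, Nat.cast_ofNat]
    ring
  have hanti : AntitoneOn
      (fun s : ℝ => g (x + s • d) - s * ⟪gradient g x, d⟫ - M / 2 * s ^ 2 * ‖d‖ ^ 2)
      (Set.Icc 0 1) := by
    refine antitoneOn_of_deriv_nonpos (convex_Icc 0 1)
      (fun s _ => (hder s).continuousAt.continuousWithinAt)
      (fun s _ => (hder s).differentiableAt.differentiableWithinAt) ?_
    intro s hs
    rw [interior_Icc] at hs
    rw [(hder s).deriv, ← inner_sub_left]
    have h1 := real_inner_le_norm (gradient g (x + s • d) - gradient g x) d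
    have h2 := hl x (x + s • d)
    rw [add_sub_cancel_left, norm_smul, Real.norm_of_nonneg hs.1.le] at h2
    nlinarith [mul_le_mul_of_nonneg_right h2 (norm_nonneg d)]
  have h := hanti (Set.left_mem_Icc.2 zero_le_one) (Set.right_mem_Icc.2 zero_le_one) zero_le_one
  have hxd : x + d = y := add_sub_cancel x y
  simp only [one_smul, zero_smul, add_zero, zero_mul, one_mul, one_pow, mul_one, hxd, ne_eq,
    OfNat.ofNat_ne_zero, not_false_eq_true, zero_pow, mul_zero, sub_zero] at h
  linarith

theorem abs_sub_sub_inner_gradient_le {g : E → ℝ} {M : ℝ} (hg : Differentiable ℝ g)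
    (hl : ∀ x y, ‖gradient g y - gradient g x‖ ≤ M * ‖y - x‖) (x y : E) :
    |g y - g x - ⟪gradient g x, y - x⟫| ≤ M / 2 * ‖y - x‖ ^ 2 := by
  have hneg : gradient (fun z => - g z) = fun z => - gradient g z := by
    funext z
    refine HasGradientAt.gradient ?_
    rw [hasGradientAt_iff_hasFDerivAt, map_neg]
    exact (hg z).hasGradientAt.hasFDerivAt.neg
  have h1 := sub_sub_inner_gradient_le hg hl x y
  have h2 := sub_sub_inner_gradient_le (g := fun z => - g z) (M := M) hg.neg
    (fun x y => by rw [hneg, neg_sub_neg, norm_sub_rev]; exact hl x y) x y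
  rw [hneg, inner_neg_left] at h2
  rw [abs_le]
  constructor <;> linarith

variable {du dv n : ℕ}

/-- A function of two blocks whose partial gradients exist and are jointly Lipschitz. -/
structure BlockSmooth (f : Vec du → Vec dv → ℝ) (L : ℝ) : Prop where
  nonneg : 0 ≤ L
  differentiable_u : ∀ v, Differentiable ℝ fun u => f u v
  differentiable_v : ∀ u, Differentiable ℝ fun v => f u v
  gradU_le : ∀ u v u' v', ‖gradU f u' v' - gradU f u v‖ ≤ L * (‖u' - u‖ + ‖v' - v‖)
  gradV_le : ∀ u v u' v', ‖gradV f u' v' - gradV f u v‖ ≤ L * (‖u' - u‖ + ‖v' - v‖)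

/-- Move from `(u, v)` to `(u, v')`, then to `(u', v')`; each move costs `L / 2` times its square.
The second move sees the `u`-gradient at `v'` instead of `v`, and this discrepancy, at most `L ‖v' -
v‖ ‖u' - u‖`, costs another `L / 2` times both squares. -/
theorem BlockSmooth.abs_sub_le {f : Vec du → Vec dv → ℝ} {L : ℝ} (hf : BlockSmooth f L)
    (u u' : Vec du) (v v' : Vec dv) :
    |f u' v' - f u v - ⟪gradU f u v, u' - u⟫ - ⟪gradV f u v, v' - v⟫|
      ≤ L * (‖u' - u‖ ^ 2 + ‖v' - v‖ ^ 2) := by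
  have h1 := abs_sub_sub_inner_gradient_le (hf.differentiable_u v') (M := L)
    (fun x y => by simpa [gradU] using hf.gradU_le x v' y v') u u'
  have h2 := abs_sub_sub_inner_gradient_le (hf.differentiable_v u) (M := L)
    (fun x y => by simpa [gradV] using hf.gradV_le u x u y) v v'
  have h3 : |⟪gradU f u v' - gradU f u v, u' - u⟫| ≤ L * ‖v' - v‖ * ‖u' - u‖ := by
    refine (abs_real_inner_le_norm _ _).trans ?_
    have := hf.gradU_le u v u v'
    simp only [sub_self, norm_zero, zero_add] at this
    exact mul_le_mul_of_nonneg_right this (norm_nonneg _)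
  rw [inner_sub_left] at h3
  change |_ - _ - ⟪gradU f u v', _⟫| ≤ _ at h1
  change |_ - _ - ⟪gradV f u v, _⟫| ≤ _ at h2
  rw [abs_le] at h1 h2 h3 ⊢
  have h4 : L * ‖v' - v‖ * ‖u' - u‖ ≤ L / 2 * (‖u' - u‖ ^ 2 + ‖v' - v‖ ^ 2) := by
    nlinarith [mul_nonneg hf.nonneg (sq_nonneg (‖u' - u‖ - ‖v' - v‖))]
  constructor <;> linarith [h1.1, h1.2, h2.1, h2.2, h3.1, h3.2]

theorem continuous_of_norm_sub_le {V : Type*} [NormedAddCommGroup V] {g : Vec du × Vec dv → V}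
    {L : ℝ} (hg : ∀ u v u' v', ‖g (u', v') - g (u, v)‖ ≤ L * (‖u' - u‖ + ‖v' - v‖)) :
    Continuous g := by
  refine continuous_iff_continuousAt.2 fun p => ?_
  refine tendsto_iff_norm_sub_tendsto_zero.2 (squeeze_zero (fun _ => norm_nonneg _)
    (fun q => hg p.1 p.2 q.1 q.2) ?_)
  have : Continuous fun q : Vec du × Vec dv => L * (‖q.1 - p.1‖ + ‖q.2 - p.2‖) := by fun_prop
  simpa using this.tendsto p

theorem BlockSmooth.continuous_gradU {f : Vec du → Vec dv → ℝ} {L : ℝ} (hf : BlockSmooth f L) :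
    Continuous fun p : Vec du × Vec dv => gradU f p.1 p.2 :=
  continuous_of_norm_sub_le hf.gradU_le

theorem BlockSmooth.continuous_gradV {f : Vec du → Vec dv → ℝ} {L : ℝ} (hf : BlockSmooth f L) :
    Continuous fun p : Vec du × Vec dv => gradV f p.1 p.2 :=
  continuous_of_norm_sub_le hf.gradV_le

/-- Differentiability in each block separately does not give joint continuity; the two-block
expansion does. -/
theorem BlockSmooth.continuous {f : Vec du → Vec dv → ℝ} {L : ℝ} (hf : BlockSmooth f L) :
    Continuous fun p : Vec du × Vec dv => f p.1 p.2 := by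
  refine continuous_iff_continuousAt.2 fun p => ?_
  refine tendsto_iff_norm_sub_tendsto_zero.2 (squeeze_zero (fun _ => norm_nonneg _)
    (g := fun q : Vec du × Vec dv => |⟪gradU f p.1 p.2, q.1 - p.1⟫|
      + |⟪gradV f p.1 p.2, q.2 - p.2⟫| + L * (‖q.1 - p.1‖ ^ 2 + ‖q.2 - p.2‖ ^ 2))
    (fun q => ?_) ?_)
  · have h := hf.abs_sub_le p.1 q.1 p.2 q.2
    rw [Real.norm_eq_abs]
    rw [abs_le] at h ⊢
    have h1 := abs_le.1 (le_refl |⟪gradU f p.1 p.2, q.1 - p.1⟫|)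
    have h2 := abs_le.1 (le_refl |⟪gradV f p.1 p.2, q.2 - p.2⟫|)
    constructor <;> linarith [h.1, h.2, h1.1, h1.2, h2.1, h2.2]
  · have : Continuous fun q : Vec du × Vec dv => |⟪gradU f p.1 p.2, q.1 - p.1⟫|
      + |⟪gradV f p.1 p.2, q.2 - p.2⟫| + L * (‖q.1 - p.1‖ ^ 2 + ‖q.2 - p.2‖ ^ 2) := by fun_prop
    simpa using this.tendsto p

variable {Ξ : Type*} [MeasurableSpace Ξ] {F : Vec du → Vec dv → Ξ → ℝ} {D : Fin n → Measure Ξ}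

theorem Smooth.blockSmooth {Lu Lv Luv Lvu : ℝ≥0} (h : Smooth F D Lu Lv Luv Lvu) (i : Fin n) :
    BlockSmooth (clientObj F D i) (max (max Lu Lv) (max Luv Lvu) : ℝ≥0) := by
  set L := max (max Lu Lv) (max Luv Lvu)
  have hLu : (Lu : ℝ) ≤ L := by exact_mod_cast (le_max_left _ _).trans (le_max_left _ _)
  have hLv : (Lv : ℝ) ≤ L := by exact_mod_cast (le_max_right _ _).trans (le_max_left _ _)
  have hLuv : (Luv : ℝ) ≤ L := by exact_mod_cast (le_max_left _ _).trans (le_max_right _ _)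
  have hLvu : (Lvu : ℝ) ≤ L := by exact_mod_cast (le_max_right _ _).trans (le_max_right _ _)
  refine ⟨L.coe_nonneg, h.differentiable_u i, h.differentiable_v i, fun u v u' v' => ?_,
    fun u v u' v' => ?_⟩
  · have h1 := (h.lipschitz_gradU_u i v').norm_sub_le u' u
    have h2 := (h.lipschitz_gradU_v i u).norm_sub_le v' v
    have h3 := norm_sub_le_norm_sub_add_norm_sub (gradU (clientObj F D i) u' v')
      (gradU (clientObj F D i) u v') (gradU (clientObj F D i) u v)
    nlinarith [mul_le_mul_of_nonneg_right hLu (norm_nonneg (u' - u)),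
      mul_le_mul_of_nonneg_right hLuv (norm_nonneg (v' - v))]
  · have h1 := (h.lipschitz_gradV_u i v').norm_sub_le u' u
    have h2 := (h.lipschitz_gradV_v i u).norm_sub_le v' v
    have h3 := norm_sub_le_norm_sub_add_norm_sub (gradV (clientObj F D i) u' v')
      (gradV (clientObj F D i) u v') (gradV (clientObj F D i) u v)
    nlinarith [mul_le_mul_of_nonneg_right hLvu (norm_nonneg (u' - u)),
      mul_le_mul_of_nonneg_right hLv (norm_nonneg (v' - v))]

theorem globalGradU_eq (h : ∀ i v, Differentiable ℝ fun u => clientObj F D i u v)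
    (u : Vec du) (v : Fin n → Vec dv) :
    globalGradU F D u v = (1 / (n : ℝ)) • ∑ i, gradU (clientObj F D i) u (v i) := by
  refine HasGradientAt.gradient ?_
  rw [hasGradientAt_iff_hasFDerivAt, map_smul, map_sum]
  exact (HasFDerivAt.fun_sum fun i _ =>
    ((h i (v i)) u).hasGradientAt.hasFDerivAt).const_mul (1 / (n : ℝ))

end Smoothness

end FedAvgP

namespace FedAvgP

open scoped RealInnerProductSpace

/-! ### Uniform sampling without replacement -/

section Sampling

variable {n m : ℕ}

/-- Average of `φ` over the `m`-element subsets of `Fin n`. -/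
noncomputable def subsetAvg (n m : ℕ) (φ : Finset (Fin n) → ℝ) : ℝ :=
  ((n.choose m : ℕ) : ℝ)⁻¹ * ∑ A ∈ Finset.powersetCard m Finset.univ, φ A

theorem subsetAvg_mono {φ ψ : Finset (Fin n) → ℝ} (h : ∀ A, A.card = m → φ A ≤ ψ A) :
    subsetAvg n m φ ≤ subsetAvg n m ψ :=
  mul_le_mul_of_nonneg_left
    (Finset.sum_le_sum fun A hA => h A (Finset.mem_powersetCard.1 hA).2) (by positivity)

theorem subsetAvg_add (φ ψ : Finset (Fin n) → ℝ) :
    subsetAvg n m (fun A => φ A + ψ A) = subsetAvg n m φ + subsetAvg n m ψ := by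
  simp only [subsetAvg, Finset.sum_add_distrib, mul_add]

theorem subsetAvg_mul_left (c : ℝ) (φ : Finset (Fin n) → ℝ) :
    subsetAvg n m (fun A => c * φ A) = c * subsetAvg n m φ := by
  simp only [subsetAvg, ← Finset.mul_sum]
  ring

theorem subsetAvg_const (hmn : m ≤ n) (c : ℝ) : subsetAvg n m (fun _ => c) = c := by
  have : ((n.choose m : ℕ) : ℝ) ≠ 0 := by exact_mod_cast (Nat.choose_pos hmn).ne'
  simp only [subsetAvg, Finset.sum_const, Finset.card_powersetCard, Finset.card_univ,
    Fintype.card_fin, nsmul_eq_mul]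
  field_simp

theorem subsetAvg_sum_comm {ι : Type*} (s : Finset ι) (φ : ι → Finset (Fin n) → ℝ) :
    subsetAvg n m (fun A => ∑ j ∈ s, φ j A) = ∑ j ∈ s, subsetAvg n m (φ j) := by
  simp only [subsetAvg, ← Finset.mul_sum]
  rw [Finset.sum_comm]

theorem subsetAvg_ite_subset (B : Finset (Fin n)) (hB : B.card ≤ m) :
    subsetAvg n m (fun A => if B ⊆ A then 1 else 0)
      = ((n - B.card).choose (m - B.card) : ℕ) / ((n.choose m : ℕ) : ℝ) := by
  rw [subsetAvg, Finset.sum_boole,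
    Finset.card_filter_powersetCard_subset B Finset.univ m (Finset.subset_univ _) hB]
  simp [div_eq_inv_mul]

theorem subsetAvg_ite_mem (hm : 1 ≤ m) (hmn : m ≤ n) (i : Fin n) :
    subsetAvg n m (fun A => if i ∈ A then 1 else 0) = (m : ℝ) / n := by
  have h := subsetAvg_ite_subset (m := m) {i} (by simpa using hm)
  simp only [Finset.singleton_subset_iff, Finset.card_singleton] at h
  rw [h]
  obtain ⟨m, rfl⟩ := Nat.exists_eq_add_of_le' hm
  obtain ⟨n, rfl⟩ := Nat.exists_eq_add_of_le' (hm.trans hmn)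
  have h1 := Nat.add_one_mul_choose_eq n m
  have h2 : (((n + 1).choose (m + 1) : ℕ) : ℝ) ≠ 0 := by
    exact_mod_cast (Nat.choose_pos hmn).ne'
  rw [Nat.add_sub_cancel, Nat.add_sub_cancel, div_eq_div_iff h2 (by positivity)]
  exact_mod_cast (by linarith : n.choose m * (n + 1) = (m + 1) * (n + 1).choose (m + 1))

theorem subsetAvg_ite_pair (hm : 1 ≤ m) (hmn : m ≤ n) {i j : Fin n} (hij : i ≠ j) :
    subsetAvg n m (fun A => if {i, j} ⊆ A then 1 else 0)
      = (m : ℝ) * (m - 1) / (n * (n - 1)) := by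
  -- A singleton contains no pair, in agreement with the factor `m - 1`; the superset count used
  -- otherwise needs `2 ≤ m`.
  obtain hm1 | hm2 := hm.eq_or_lt
  · subst hm1
    rw [subsetAvg, Finset.sum_eq_zero]
    · simp
    · intro A hA
      rw [if_neg]
      intro h
      have := Finset.card_le_card h
      rw [Finset.card_pair hij, (Finset.mem_powersetCard.1 hA).2] at this
      omega
  · have h := subsetAvg_ite_subset (m := m) {i, j} (by rw [Finset.card_pair hij]; exact hm2)
    rw [h, Finset.card_pair hij]
    obtain ⟨m, rfl⟩ := Nat.exists_eq_add_of_le' (show 2 ≤ m from hm2)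
    obtain ⟨n, rfl⟩ := Nat.exists_eq_add_of_le' ((show 2 ≤ m + 2 by omega).trans hmn)
    have h1 := Nat.add_one_mul_choose_eq n m
    have h2 := Nat.add_one_mul_choose_eq (n + 1) (m + 1)
    have h3 : (((n + 2).choose (m + 2) : ℕ) : ℝ) ≠ 0 := by
      exact_mod_cast (Nat.choose_pos hmn).ne'
    have h4 : ((n + 2 : ℕ) : ℝ) * ((n + 2 : ℕ) - 1) ≠ 0 := by
      push_cast
      have : (0 : ℝ) ≤ n := n.cast_nonneg
      have h5 : (n : ℝ) + 2 - 1 ≠ 0 := by linarith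
      exact mul_ne_zero (by positivity) h5
    rw [Nat.add_sub_cancel, Nat.add_sub_cancel, div_eq_div_iff h3 h4]
    have h1' : ((n : ℝ) + 1) * n.choose m = (n + 1).choose (m + 1) * (m + 1) := by
      exact_mod_cast h1
    have h2' : ((n : ℝ) + 2) * (n + 1).choose (m + 1) = (n + 2).choose (m + 2) * (m + 2) := by
      exact_mod_cast h2
    push_cast
    linear_combination ((n : ℝ) + 2) * h1' + ((m : ℝ) + 1) * h2'

theorem subsetAvg_sum (hm : 1 ≤ m) (hmn : m ≤ n) (a : Fin n → ℝ) :
    subsetAvg n m (fun A => ∑ i ∈ A, a i) = (m : ℝ) / n * ∑ i, a i := by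
  have : (fun A : Finset (Fin n) => ∑ i ∈ A, a i)
      = fun A => ∑ i, a i * (if i ∈ A then 1 else 0) := by
    funext A
    simp
  rw [this, subsetAvg_sum_comm, Finset.mul_sum]
  refine Finset.sum_congr rfl fun i _ => ?_
  rw [subsetAvg_mul_left, subsetAvg_ite_mem hm hmn, mul_comm]

variable {E : Type*} [NormedAddCommGroup E] [InnerProductSpace ℝ E]

theorem sum_norm_sub_mean_sq (hn : 1 ≤ n) (a : Fin n → E) :
    ∑ i, ‖a i - (1 / (n : ℝ)) • ∑ j, a j‖ ^ 2
      = ∑ i, ‖a i‖ ^ 2 - n * ‖(1 / (n : ℝ)) • ∑ j, a j‖ ^ 2 := by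
  have hn' : (n : ℝ) ≠ 0 := by exact_mod_cast (by omega : n ≠ 0)
  set c := (1 / (n : ℝ)) • ∑ j, a j with hc
  have hs : ∑ j, a j = (n : ℝ) • c := by rw [hc, smul_smul]; field_simp; simp
  simp only [norm_sub_sq_real, Finset.sum_add_distrib, Finset.sum_sub_distrib, ← Finset.mul_sum,
    ← sum_inner, hs, inner_smul_left, real_inner_self_eq_norm_sq]
  simp
  ring

/-- Expanding the square leaves the probability that `i` and `j` are both drawn: `p` off the
diagonal and `m / n` on it. For `n = 1` there is no off-diagonal pair, and the convention `0 / 0 =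
0` is harmless. -/
theorem subsetAvg_norm_sum_sq_eq (hm : 1 ≤ m) (hmn : m ≤ n) (a : Fin n → E) :
    subsetAvg n m (fun A => ‖∑ i ∈ A, a i‖ ^ 2)
      = (m : ℝ) * (m - 1) / (n * (n - 1)) * ‖∑ i, a i‖ ^ 2
        + ((m : ℝ) / n - (m : ℝ) * (m - 1) / (n * (n - 1))) * ∑ i, ‖a i‖ ^ 2 := by
  set p := (m : ℝ) * (m - 1) / (n * (n - 1)) with hp
  have h1 : (fun A : Finset (Fin n) => ‖∑ i ∈ A, a i‖ ^ 2)
      = fun A => ∑ i, ∑ j, ⟪a i, a j⟫ * (if {i, j} ⊆ A then 1 else 0) := by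
    funext A
    have : ∀ i j, ⟪a i, a j⟫ * (if {i, j} ⊆ A then 1 else 0)
        = if i ∈ A then if j ∈ A then ⟪a i, a j⟫ else 0 else 0 := by
      intro i j
      by_cases hi : i ∈ A <;> by_cases hj : j ∈ A <;> simp [Finset.insert_subset_iff, hi, hj]
    simp only [this]
    rw [← real_inner_self_eq_norm_sq, sum_inner]
    simp [inner_sum]
  have h2 : ∀ i j : Fin n, subsetAvg n m (fun A => if {i, j} ⊆ A then 1 else 0)
      = p + if i = j then (m : ℝ) / n - p else 0 := by
    intro i j
    split_ifs with h
    · subst h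
      simpa using subsetAvg_ite_mem hm hmn i
    · rw [subsetAvg_ite_pair hm hmn h, add_zero]
  rw [h1]
  simp only [subsetAvg_sum_comm, subsetAvg_mul_left, h2]
  simp only [mul_add, Finset.sum_add_distrib,
    mul_ite, mul_zero, Finset.sum_ite_eq, Finset.mem_univ, if_true, ← Finset.sum_mul,
    ← inner_sum, ← sum_inner, real_inner_self_eq_norm_sq]
  ring

/-- Splitting the second moments into mean and spread gives the exact variance factor `m (n - m) /
(n (n - 1))`. For `n ≥ 2` one has `n ≤ 2 (n - 1)`, whence the factor `2`; for `n = 1` the spread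
vanishes. -/
theorem subsetAvg_norm_sum_sq_le (hm : 1 ≤ m) (hmn : m ≤ n) (a : Fin n → E) :
    subsetAvg n m (fun A => ‖∑ i ∈ A, a i‖ ^ 2)
      ≤ (m : ℝ) ^ 2 * ‖(1 / (n : ℝ)) • ∑ i, a i‖ ^ 2
        + 2 * m * (n - m) / n ^ 2 * ∑ i, ‖a i - (1 / (n : ℝ)) • ∑ j, a j‖ ^ 2 := by
  have hn := hm.trans hmn
  have hm0 : (1 : ℝ) ≤ m := by exact_mod_cast hm
  have hmn0 : (m : ℝ) ≤ n := by exact_mod_cast hmn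
  have hs : ‖∑ j, a j‖ ^ 2 = (n : ℝ) ^ 2 * ‖(1 / (n : ℝ)) • ∑ j, a j‖ ^ 2 := by
    rw [norm_smul, mul_pow, ← mul_assoc, Real.norm_of_nonneg (by positivity)]
    field_simp
  have hsq : ∑ i, ‖a i‖ ^ 2 = ∑ i, ‖a i - (1 / (n : ℝ)) • ∑ j, a j‖ ^ 2
      + n * ‖(1 / (n : ℝ)) • ∑ j, a j‖ ^ 2 := by
    rw [sum_norm_sub_mean_sq hn]; ring
  rw [subsetAvg_norm_sum_sq_eq hm hmn, hs, hsq]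
  set V := ∑ i, ‖a i - (1 / (n : ℝ)) • ∑ j, a j‖ ^ 2 with hV
  have hV0 : 0 ≤ V := Finset.sum_nonneg fun _ _ => by positivity
  set q := ‖(1 / (n : ℝ)) • ∑ j, a j‖ ^ 2
  obtain hn1 | hn2 := hn.eq_or_lt
  · subst hn1
    have : m = 1 := le_antisymm hmn hm
    subst this
    have : V = 0 := by simp [hV]
    rw [this]
    simp
  · have hn2' : (2 : ℝ) ≤ n := by exact_mod_cast hn2
    have hne : (n : ℝ) - 1 ≠ 0 := by linarith
    have e1 : (m : ℝ) * (m - 1) / (n * (n - 1)) * ((n : ℝ) ^ 2 * q)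
        + ((m : ℝ) / n - (m : ℝ) * (m - 1) / (n * (n - 1))) * (V + n * q)
        = m ^ 2 * q + m * (n - m) / (n * (n - 1)) * V := by
      field_simp
      ring
    rw [e1]
    have e2 : (m : ℝ) * (n - m) / (n * (n - 1)) ≤ 2 * m * (n - m) / n ^ 2 := by
      rw [div_le_div_iff₀ (by nlinarith) (by positivity)]
      have : 0 ≤ (m : ℝ) * (n - m) * n := by
        have := mul_nonneg (zero_le_one.trans hm0) (sub_nonneg.2 hmn0)
        positivity
      nlinarith
    linarith [mul_le_mul_of_nonneg_right e2 hV0]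

end Sampling

end FedAvgP

namespace FedAvgP

open scoped RealInnerProductSpace

/-! ### Deterministic algebra of one round -/

section RoundAlgebra

variable {n m : ℕ} {E E' : Type*} [NormedAddCommGroup E] [InnerProductSpace ℝ E]
  [NormedAddCommGroup E'] [InnerProductSpace ℝ E']

theorem norm_mean_sq_le (hn : 1 ≤ n) (a : Fin n → E) :
    ‖(1 / (n : ℝ)) • ∑ i, a i‖ ^ 2 ≤ 1 / n * ∑ i, ‖a i‖ ^ 2 := by
  have hn' : (0 : ℝ) < n := by exact_mod_cast hn
  have h := sum_norm_sub_mean_sq hn a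
  have h0 : 0 ≤ ∑ i, ‖a i - (1 / (n : ℝ)) • ∑ j, a j‖ ^ 2 :=
    Finset.sum_nonneg fun _ _ => by positivity
  rw [div_mul_eq_mul_div, one_mul, le_div_iff₀ hn']
  linarith

/-- This is polarization of `‖a - κ • g‖ ^ 2`, scaled by `γ / (2 κ)`. The negative square of `a` is
kept because it later absorbs the second-order term of the round. -/
theorem neg_inner_le {γ κ L w : ℝ} (hγ : 0 < γ) (hκ : 0 < κ) {g a : E}
    (h : ‖a - κ • g‖ ^ 2 ≤ 2 * κ * L ^ 2 * w) :
    -γ * ⟪g, a⟫ ≤ -(γ * κ / 2) * ‖g‖ ^ 2 - γ / (2 * κ) * ‖a‖ ^ 2 + γ * L ^ 2 * w := by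
  rw [norm_sub_sq_real, norm_smul, mul_pow, Real.norm_of_nonneg hκ.le, inner_smul_right,
    real_inner_comm] at h
  have h' := mul_le_mul_of_nonneg_left h (show 0 ≤ γ / (2 * κ) by positivity)
  have e1 : γ / (2 * κ) * (2 * κ * L ^ 2 * w) = γ * L ^ 2 * w := by field_simp
  have e2 : γ / (2 * κ) * (‖a‖ ^ 2 - 2 * (κ * ⟪g, a⟫) + κ ^ 2 * ‖g‖ ^ 2)
      = γ / (2 * κ) * ‖a‖ ^ 2 - γ * ⟪g, a⟫ + γ * κ / 2 * ‖g‖ ^ 2 := by field_simp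
  linarith

/-- Write `a i` as `κ • g i` plus an error; centring is linear. The spread of the `g i` is at most
`n b ^ 2` by dissimilarity, and the spread of the errors is at most their sum of squares. -/
theorem sum_norm_sub_mean_sq_le {κ w b L : ℝ} (hn : 1 ≤ n) {g a : Fin n → E} {W : Fin n → ℝ}
    (ha : ∀ i, ‖a i - κ • g i‖ ^ 2 ≤ 2 * κ * L ^ 2 * W i)
    (hg : 1 / (n : ℝ) * ∑ i, ‖g i‖ ^ 2 ≤ b ^ 2 + ‖(1 / (n : ℝ)) • ∑ i, g i‖ ^ 2)
    (hw : w = 1 / (n : ℝ) * ∑ i, W i) :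
    ∑ i, ‖a i - (1 / (n : ℝ)) • ∑ j, a j‖ ^ 2
      ≤ n * (2 * κ ^ 2 * b ^ 2 + 4 * κ * L ^ 2 * w) := by
  have hn' : (0 : ℝ) < n := by exact_mod_cast hn
  have h1 : ∀ i, ‖a i - (1 / (n : ℝ)) • ∑ j, a j‖ ^ 2
      ≤ 2 * (κ ^ 2 * ‖g i - (1 / (n : ℝ)) • ∑ j, g j‖ ^ 2)
        + 2 * ‖(a i - κ • g i) - (1 / (n : ℝ)) • ∑ j, (a j - κ • g j)‖ ^ 2 := by
    intro i
    have e : a i - (1 / (n : ℝ)) • ∑ j, a j = κ • (g i - (1 / (n : ℝ)) • ∑ j, g j)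
        + ((a i - κ • g i) - (1 / (n : ℝ)) • ∑ j, (a j - κ • g j)) := by
      rw [Finset.sum_sub_distrib, ← Finset.smul_sum]
      module
    rw [e, ← sq_abs κ, ← Real.norm_eq_abs, ← mul_pow, ← norm_smul]
    have := parallelogram_law_with_norm ℝ (κ • (g i - (1 / (n : ℝ)) • ∑ j, g j))
      ((a i - κ • g i) - (1 / (n : ℝ)) • ∑ j, (a j - κ • g j))
    nlinarith [sq_nonneg ‖κ • (g i - (1 / (n : ℝ)) • ∑ j, g j)
      - ((a i - κ • g i) - (1 / (n : ℝ)) • ∑ j, (a j - κ • g j))‖]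
  refine (Finset.sum_le_sum fun i _ => h1 i).trans ?_
  rw [Finset.sum_add_distrib, ← Finset.mul_sum, ← Finset.mul_sum, ← Finset.mul_sum,
    sum_norm_sub_mean_sq hn, sum_norm_sub_mean_sq hn]
  have h2 : ∑ i, ‖a i - κ • g i‖ ^ 2 ≤ 2 * κ * L ^ 2 * (n * w) := by
    refine (Finset.sum_le_sum fun i _ => ha i).trans_eq ?_
    rw [← Finset.mul_sum, hw]
    field_simp
  have h3 : ∑ i, ‖g i‖ ^ 2 - n * ‖(1 / (n : ℝ)) • ∑ i, g i‖ ^ 2 ≤ n * b ^ 2 := by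
    rw [div_mul_eq_mul_div, one_mul, div_le_iff₀ hn'] at hg
    linarith
  have h4 : 0 ≤ n * ‖(1 / (n : ℝ)) • ∑ i, (a i - κ • g i)‖ ^ 2 := by positivity
  have h5 := mul_le_mul_of_nonneg_left h3 (sq_nonneg κ)
  nlinarith

/-- Deterministic part of the one-round descent: `a i`, `c i` are the sums of the gradients along
the `κ` local steps, `g i`, `q i` the gradients at the start of the round. -/
theorem subsetAvg_round_le {γ κ L b w : ℝ} (hm : 1 ≤ m) (hmn : m ≤ n) (hγ : 0 < γ) (hκ : 1 ≤ κ)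
    (hL : 0 ≤ L) (hγL : 32 * L * κ * γ ≤ 1) {g a : Fin n → E} {q c : Fin n → E'} {W : Fin n → ℝ}
    (hW : ∀ i, 0 ≤ W i)
    (ha : ∀ i, ‖a i - κ • g i‖ ^ 2 ≤ 2 * κ * L ^ 2 * W i)
    (hc : ∀ i, ‖c i - κ • q i‖ ^ 2 ≤ 2 * κ * L ^ 2 * W i)
    (hg : 1 / (n : ℝ) * ∑ i, ‖g i‖ ^ 2 ≤ b ^ 2 + ‖(1 / (n : ℝ)) • ∑ i, g i‖ ^ 2)
    (hw : w = 1 / (n : ℝ) * ∑ i, W i) :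
    subsetAvg n m (fun A => -(γ / m) * ∑ i ∈ A, ⟪(1 / (n : ℝ)) • ∑ i, g i, a i⟫
        + 2 * L * γ ^ 2 / m ^ 2 * ‖∑ i ∈ A, a i‖ ^ 2
        + 1 / n * ∑ i ∈ A, (-γ * ⟪q i, c i⟫ + 2 * L * γ ^ 2 * ‖c i‖ ^ 2))
      ≤ -(γ * κ / 2) * (‖(1 / (n : ℝ)) • ∑ i, g i‖ ^ 2 + m / n ^ 2 * ∑ i, ‖q i‖ ^ 2)
        + 8 * (n - m) / (m * n) * L * κ ^ 2 * γ ^ 2 * b ^ 2 + 5 / 2 * γ * L ^ 2 * w := by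
  have hn := hm.trans hmn
  have hm0 : (1 : ℝ) ≤ m := by exact_mod_cast hm
  have hmn0 : (m : ℝ) ≤ n := by exact_mod_cast hmn
  have hn0 : (0 : ℝ) < n := by linarith
  have hκ0 : 0 < κ := by linarith
  have hw0 : 0 ≤ w := by
    rw [hw]; exact mul_nonneg (by positivity) (Finset.sum_nonneg fun i _ => hW i)
  set gb := (1 / (n : ℝ)) • ∑ i, g i with hgb
  set ab := (1 / (n : ℝ)) • ∑ i, a i with hab
  -- This needs only `4 L κ γ ≤ 1`. It lets the negative squares of `neg_inner_le` absorb the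
  -- second-order terms of both blocks.
  have hstep : 2 * L * γ ^ 2 ≤ γ / (2 * κ) := by
    rw [le_div_iff₀ (by positivity)]
    have : 0 ≤ 28 * L * κ * γ * γ := by positivity
    nlinarith
  rw [subsetAvg_add, subsetAvg_add, subsetAvg_mul_left, subsetAvg_mul_left, subsetAvg_mul_left,
    subsetAvg_sum hm hmn, subsetAvg_sum hm hmn]
  have hmean : ‖ab - κ • gb‖ ^ 2 ≤ 2 * κ * L ^ 2 * w := by
    have e : ab - κ • gb = (1 / (n : ℝ)) • ∑ i, (a i - κ • g i) := by
      rw [Finset.sum_sub_distrib, ← Finset.smul_sum, hab, hgb]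
      module
    rw [e]
    refine (norm_mean_sq_le hn _).trans ?_
    rw [hw]
    refine (mul_le_mul_of_nonneg_left (Finset.sum_le_sum fun i _ => ha i)
      (by positivity)).trans_eq ?_
    rw [← Finset.mul_sum]
    ring
  have hlin : -(γ / m) * ((m : ℝ) / n * ∑ i, ⟪gb, a i⟫)
      ≤ -(γ * κ / 2) * ‖gb‖ ^ 2 - γ / (2 * κ) * ‖ab‖ ^ 2 + γ * L ^ 2 * w := by
    refine le_trans (le_of_eq ?_) (neg_inner_le hγ hκ0 hmean)
    rw [hab, inner_smul_right, inner_sum]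
    field_simp
  have hquad : 2 * L * γ ^ 2 / m ^ 2 * subsetAvg n m (fun A => ‖∑ i ∈ A, a i‖ ^ 2)
      ≤ γ / (2 * κ) * ‖ab‖ ^ 2 + 8 * (n - m) / (m * n) * L * κ ^ 2 * γ ^ 2 * b ^ 2
        + 1 / 2 * γ * L ^ 2 * w := by
    have h1 := subsetAvg_norm_sum_sq_le hm hmn a
    have h2 := sum_norm_sub_mean_sq_le hn ha hg hw
    have hcoef : (0 : ℝ) ≤ 2 * m * (n - m) / n ^ 2 :=
      div_nonneg (mul_nonneg (by positivity) (sub_nonneg.2 hmn0)) (by positivity)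
    have h3 := h1.trans (add_le_add le_rfl (mul_le_mul_of_nonneg_left h2 hcoef))
    have h4 := mul_le_mul_of_nonneg_left h3 (show 0 ≤ 2 * L * γ ^ 2 / m ^ 2 by positivity)
    refine h4.trans ?_
    set r : ℝ := (n - m) / (m * n) with hr
    have hr1 : r ≤ 1 := by
      rw [hr, div_le_one (by positivity)]
      nlinarith
    have e : 2 * L * γ ^ 2 / m ^ 2 * ((m : ℝ) ^ 2 * ‖ab‖ ^ 2
        + 2 * m * (n - m) / n ^ 2 * (n * (2 * κ ^ 2 * b ^ 2 + 4 * κ * L ^ 2 * w)))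
        = 2 * L * γ ^ 2 * ‖ab‖ ^ 2 + 8 * r * L * κ ^ 2 * γ ^ 2 * b ^ 2
          + 16 * r * L * κ * γ * (γ * L ^ 2 * w) := by
      rw [hr]
      field_simp
      ring
    rw [e]
    -- Here `r ≤ 1` and `16 L κ γ ≤ 1 / 2`. The final drift coefficient `5 / 2` is `1` from the
    -- linear term of the shared block, `1 / 2` from here, and `1` from the personal blocks.
    have h5 : 16 * r * L * κ * γ * (γ * L ^ 2 * w) ≤ 1 / 2 * (γ * L ^ 2 * w) := by
      refine mul_le_mul_of_nonneg_right ?_ (by positivity)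
      have : r * (L * κ * γ) ≤ 1 * (L * κ * γ) :=
        mul_le_mul_of_nonneg_right hr1 (by positivity)
      linarith
    have h6 := mul_le_mul_of_nonneg_right hstep (sq_nonneg ‖ab‖)
    have e2 : 8 * ((n : ℝ) - m) / (m * n) = 8 * r := by rw [hr]; ring
    rw [e2]
    linarith
  have hv : 1 / (n : ℝ) * ((m : ℝ) / n * ∑ i, (-γ * ⟪q i, c i⟫ + 2 * L * γ ^ 2 * ‖c i‖ ^ 2))
      ≤ -(γ * κ / 2) * (m / n ^ 2 * ∑ i, ‖q i‖ ^ 2) + γ * L ^ 2 * w := by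
    have h1 : ∑ i, (-γ * ⟪q i, c i⟫ + 2 * L * γ ^ 2 * ‖c i‖ ^ 2)
        ≤ -(γ * κ / 2) * ∑ i, ‖q i‖ ^ 2 + γ * L ^ 2 * (n * w) := by
      have e : (n : ℝ) * w = ∑ i, W i := by rw [hw]; field_simp
      rw [e, Finset.mul_sum, Finset.mul_sum, ← Finset.sum_add_distrib]
      refine Finset.sum_le_sum fun i _ => ?_
      have := neg_inner_le hγ hκ0 (hc i)
      linarith [mul_le_mul_of_nonneg_right hstep (sq_nonneg ‖c i‖)]
    have h2 := mul_le_mul_of_nonneg_left h1 (show 0 ≤ (m : ℝ) / n ^ 2 by positivity)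
    have h3 : (m : ℝ) / n ^ 2 * (γ * L ^ 2 * (n * w)) ≤ γ * L ^ 2 * w := by
      have e : (m : ℝ) / n ^ 2 * (γ * L ^ 2 * (n * w)) = m / n * (γ * L ^ 2 * w) := by field_simp
      rw [e]
      exact mul_le_of_le_one_left (by positivity) ((div_le_one hn0).2 hmn0)
    have e : ∀ s : ℝ, 1 / (n : ℝ) * ((m : ℝ) / n * s) = m / n ^ 2 * s := fun s => by
      field_simp
    rw [e]
    linarith
  linarith

end RoundAlgebra

end FedAvgP

namespace FedAvgP

open scoped RealInnerProductSpace

/-! ### Independence and orthogonality -/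

section Probability

variable {Ω : Type*} {𝓜 mΩ : MeasurableSpace Ω} {P : Measure Ω}

/-- On intersections, `P (a ∩ b ∩ c) = P (a ∩ c) P b = P a P c P b = P (a ∩ b) P c`, and the sets `a
∩ b` form a π-system generating `m₁ ⊔ m₂`. It serves to separate one sample from the other samples
joined with the client draws, and one draw from the other draws joined with the samples. -/
theorem indep_sup_of_indep_sup [IsProbabilityMeasure P] {m₁ m₂ m₃ : MeasurableSpace Ω}
    (h₁ : m₁ ≤ mΩ) (h₂ : m₂ ≤ mΩ) (h₃ : m₃ ≤ mΩ) (h13 : Indep m₁ m₃ P)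
    (h132 : Indep (m₁ ⊔ m₃) m₂ P) : Indep (m₁ ⊔ m₂) m₃ P := by
  let p : Set (Set Ω) := {s | ∃ a b, MeasurableSet[m₁] a ∧ MeasurableSet[m₂] b ∧ a ∩ b = s}
  refine IndepSets.indep (p1 := p) (p2 := {s | MeasurableSet[m₃] s}) (sup_le h₁ h₂) h₃ ?_
    (@MeasurableSpace.isPiSystem_measurableSet Ω m₃) ?_
    (@MeasurableSpace.generateFrom_measurableSet Ω m₃).symm ?_
  · rintro _ ⟨a, b, ha, hb, rfl⟩ _ ⟨a', b', ha', hb', rfl⟩ -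
    exact ⟨a ∩ a', b ∩ b', MeasurableSet.inter ha ha', MeasurableSet.inter hb hb',
      Set.inter_inter_inter_comm _ _ _ _⟩
  · refine le_antisymm (sup_le (fun s hs => ?_) fun s hs => ?_)
      (MeasurableSpace.generateFrom_le ?_)
    · exact MeasurableSpace.measurableSet_generateFrom
        ⟨s, Set.univ, hs, MeasurableSet.univ, Set.inter_univ s⟩
    · exact MeasurableSpace.measurableSet_generateFrom
        ⟨Set.univ, s, MeasurableSet.univ, hs, Set.univ_inter s⟩
    · rintro _ ⟨a, b, ha, hb, rfl⟩
      have ha' : MeasurableSet[m₁ ⊔ m₂] a := (le_sup_left : m₁ ≤ m₁ ⊔ m₂) a ha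
      have hb' : MeasurableSet[m₁ ⊔ m₂] b := (le_sup_right : m₂ ≤ m₁ ⊔ m₂) b hb
      exact ha'.inter hb'
  · rw [IndepSets_iff]
    rintro _ c ⟨a, b, ha, hb, rfl⟩ hc
    rw [Indep_iff] at h13 h132
    have ha' : MeasurableSet[m₁ ⊔ m₃] a := (le_sup_left : m₁ ≤ m₁ ⊔ m₃) a ha
    have hc' : MeasurableSet[m₁ ⊔ m₃] c := (le_sup_right : m₃ ≤ m₁ ⊔ m₃) c hc
    rw [Set.inter_right_comm, h132 _ b (ha'.inter hc') hb, h13 a c ha hc, h132 a b ha' hb,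
      mul_right_comm]

theorem integrable_inner_of_memLp_two {E : Type*} [NormedAddCommGroup E] [InnerProductSpace ℝ E]
    {X Y : Ω → E} (hX : MemLp X 2 P) (hY : MemLp Y 2 P) :
    Integrable (fun ω => ⟪X ω, Y ω⟫) P := by
  refine (hX.norm.integrable_mul hY.norm).mono'
    (hX.aestronglyMeasurable.inner hY.aestronglyMeasurable) (ae_of_all _ fun ω => ?_)
  exact norm_inner_le_norm _ _

theorem integral_norm_sum_sq_le {E ι : Type*} [NormedAddCommGroup E] [InnerProductSpace ℝ E]
    (s : Finset ι) {N : ι → Ω → E} {v : ℝ}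
    (hN : ∀ i ∈ s, MemLp (N i) 2 P)
    (horth : ∀ i ∈ s, ∀ j ∈ s, i ≠ j → ∫ ω, ⟪N i ω, N j ω⟫ ∂P = 0)
    (hv : ∀ i ∈ s, ∫ ω, ‖N i ω‖ ^ 2 ∂P ≤ v) :
    ∫ ω, ‖∑ i ∈ s, N i ω‖ ^ 2 ∂P ≤ s.card * v := by
  have h1 : ∀ ω, ‖∑ i ∈ s, N i ω‖ ^ 2 = ∑ i ∈ s, ∑ j ∈ s, ⟪N i ω, N j ω⟫ := by
    intro ω
    rw [← real_inner_self_eq_norm_sq, sum_inner]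
    simp only [inner_sum]
  simp only [h1]
  rw [integral_finsetSum _ fun i hi => integrable_finsetSum _ fun j hj =>
    integrable_inner_of_memLp_two (hN i hi) (hN j hj), ← nsmul_eq_mul, ← Finset.sum_const]
  refine Finset.sum_le_sum fun i hi => ?_
  rw [integral_finsetSum _ fun j hj => integrable_inner_of_memLp_two (hN i hi) (hN j hj),
    Finset.sum_eq_single_of_mem i hi fun j hj hji => horth i hi j hj hji.symm]
  simpa only [real_inner_self_eq_norm_sq] using hv i hi

theorem indepFun_of_indep {α β : Type*} [MeasurableSpace α] [MeasurableSpace β]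
    {X : Ω → α} {ζ : Ω → β} (hX : Measurable[𝓜] X)
    (hind : Indep 𝓜 (MeasurableSpace.comap ζ inferInstance) P) : IndepFun X ζ P :=
  (IndepFun_iff_Indep _ _ _).2 (indep_of_indep_of_le_left hind hX.comap_le)

/-- Decompose over the values of `S`: the indicator of each value is independent of the
`𝓜`-measurable `Φ A`, so each term factors. This reduces a round with a random client set to rounds
with fixed sets. -/
theorem integral_comp_subset [IsProbabilityMeasure P] {n m : ℕ} (hmn : m ≤ n)
    {S : Ω → Finset (Fin n)} (hS : Measurable S) (hle : 𝓜 ≤ mΩ)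
    (hind : Indep 𝓜 (MeasurableSpace.comap S inferInstance) P)
    (hunif : ∀ A : Finset (Fin n), A.card = m →
      P {ω | S ω = A} = ((n.choose m : ℕ) : ENNReal)⁻¹)
    {Φ : Finset (Fin n) → Ω → ℝ} (hΦ : ∀ A, Measurable[𝓜] (Φ A))
    (hint : ∀ A, Integrable (Φ A) P) :
    Integrable (fun ω => Φ (S ω) ω) P ∧
      ∫ ω, Φ (S ω) ω ∂P = subsetAvg n m fun A => ∫ ω, Φ A ω ∂P := by
  have hdec : (fun ω => Φ (S ω) ω) = fun ω => ∑ A, (if S ω = A then 1 else 0) * Φ A ω := by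
    funext ω
    simp
  have hmeas : ∀ A : Finset (Fin n), Measurable fun B : Finset (Fin n) =>
      if B = A then (1 : ℝ) else 0 := fun A =>
    Measurable.ite (measurableSet_singleton A) measurable_const measurable_const
  have hindep : ∀ A, IndepFun (fun ω => if S ω = A then (1 : ℝ) else 0) (Φ A) P := fun A =>
    ((indepFun_of_indep (hΦ A) hind).symm).comp (hmeas A) measurable_id
  have hInt : ∀ A, Integrable (fun ω => (if S ω = A then (1 : ℝ) else 0) * Φ A ω) P := fun A =>
    (hint A).bdd_mul ((hmeas A).comp hS).aestronglyMeasurable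
      (c := 1) (ae_of_all _ fun ω => by split_ifs <;> simp)
  have hsing : ∀ A, MeasurableSet {ω | S ω = A} := fun A => hS (measurableSet_singleton A)
  have hprob : ∀ A, ∫ ω, (if S ω = A then (1 : ℝ) else 0) ∂P = P.real {ω | S ω = A} := by
    intro A
    rw [← integral_indicator_one (hsing A)]
    refine integral_congr_ae (ae_of_all _ fun ω => ?_)
    simp [Set.indicator_apply]
  have hC : ((n.choose m : ℕ) : ℝ) ≠ 0 := by exact_mod_cast (Nat.choose_pos hmn).ne'
  have hpm : ∀ A : Finset (Fin n), A.card = m →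
      P.real {ω | S ω = A} = ((n.choose m : ℕ) : ℝ)⁻¹ := by
    intro A hA
    rw [Measure.real, hunif A hA, ENNReal.toReal_inv, ENNReal.toReal_natCast]
  have htot : ∑ A, P.real {ω | S ω = A} = 1 := by
    simp only [← hprob]
    rw [← integral_finsetSum _ fun A _ => ?_]
    · simp
    · exact Integrable.of_bound ((hmeas A).comp hS).aestronglyMeasurable 1
        (ae_of_all _ fun ω => by split_ifs <;> simp)
  have hsplit : ∀ φ : Finset (Fin n) → ℝ, ∑ A, φ A
      = ∑ A ∈ Finset.powersetCard m Finset.univ, φ A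
        + ∑ A ∈ (Finset.powersetCard m Finset.univ)ᶜ, φ A := fun φ =>
    (Finset.sum_add_sum_compl _ φ).symm
  have hsum : ∑ A ∈ Finset.powersetCard m Finset.univ, P.real {ω | S ω = A} = 1 := by
    rw [Finset.sum_congr rfl fun A hA => hpm A (Finset.mem_powersetCard.1 hA).2,
      Finset.sum_const, Finset.card_powersetCard, Finset.card_univ, Fintype.card_fin,
      nsmul_eq_mul, mul_inv_cancel₀ hC]
  -- The law of `S` is prescribed on `m`-element sets only; these already carry total mass one, so
  -- all other sets are null.
  have hzero : ∀ A ∈ (Finset.powersetCard m (Finset.univ : Finset (Fin n)))ᶜ,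
      P.real {ω | S ω = A} = 0 := by
    refine (Finset.sum_eq_zero_iff_of_nonneg
      (f := fun A => P.real {ω | S ω = A}) fun A _ => measureReal_nonneg).1 ?_
    rw [hsplit, hsum] at htot
    linarith
  rw [hdec]
  refine ⟨integrable_finsetSum _ fun A _ => hInt A, ?_⟩
  rw [integral_finsetSum _ fun A _ => hInt A]
  have hval : ∀ A, ∫ ω, (if S ω = A then (1 : ℝ) else 0) * Φ A ω ∂P
      = P.real {ω | S ω = A} * ∫ ω, Φ A ω ∂P := by
    intro A
    rw [(hindep A).integral_fun_mul_eq_mul_integral ((hmeas A).comp hS).aestronglyMeasurable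
      ((hΦ A).mono hle le_rfl).aestronglyMeasurable, hprob]
  simp only [hval]
  rw [hsplit, Finset.sum_eq_zero (s := (Finset.powersetCard m Finset.univ)ᶜ)
    fun A hA => by rw [hzero A hA, zero_mul], add_zero, subsetAvg, Finset.mul_sum]
  exact Finset.sum_congr rfl fun A hA => by rw [hpm A (Finset.mem_powersetCard.1 hA).2]

end Probability

/-! ### Stochastic gradient oracles at random points -/

section Oracle

variable {du dv d : ℕ} {Ξ : Type*} [MeasurableSpace Ξ]

/-- An unbiased oracle `g (u, v; ξ)`, `ξ ∼ D`, of variance at most `σ ^ 2` for a jointly Lipschitz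
vector field `G (u, v)`. -/
structure Oracle (g : Vec du → Vec dv → Ξ → Vec d) (G : Vec du → Vec dv → Vec d)
    (D : Measure Ξ) (L σ : ℝ) : Prop where
  measurable : Measurable fun p : (Vec du × Vec dv) × Ξ => g p.1.1 p.1.2 p.2
  norm_sub_le : ∀ u v u' v', ‖G u' v' - G u v‖ ≤ L * (‖u' - u‖ + ‖v' - v‖)
  integrable : ∀ u v, Integrable (g u v) D
  integral_eq : ∀ u v, ∫ ξ, g u v ξ ∂D = G u v
  integrable_sq : ∀ u v, Integrable (fun ξ => ‖g u v ξ - G u v‖ ^ 2) D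
  variance_le : ∀ u v, ∫ ξ, ‖g u v ξ - G u v‖ ^ 2 ∂D ≤ σ ^ 2

variable {g : Vec du → Vec dv → Ξ → Vec d} {G : Vec du → Vec dv → Vec d} {D : Measure Ξ}
  {L σ : ℝ}

theorem Oracle.continuous (h : Oracle g G D L σ) :
    Continuous fun p : Vec du × Vec dv => G p.1 p.2 :=
  continuous_of_norm_sub_le h.norm_sub_le

theorem Oracle.measurable_noise (h : Oracle g G D L σ) :
    Measurable fun p : (Vec du × Vec dv) × Ξ => g p.1.1 p.1.2 p.2 - G p.1.1 p.1.2 :=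
  h.measurable.sub (h.continuous.measurable.comp measurable_fst)

variable {Ω : Type*} {𝓜 mΩ : MeasurableSpace Ω} {P : Measure Ω} [IsProbabilityMeasure P]

theorem Oracle.memLp_mean (h : Oracle g G D L σ) (hL : 0 ≤ L) {U : Ω → Vec du} {V : Ω → Vec dv}
    (hU : MemLp U 2 P) (hV : MemLp V 2 P) : MemLp (fun ω => G (U ω) (V ω)) 2 P := by
  have hmeas : AEStronglyMeasurable (fun ω => G (U ω) (V ω)) P :=
    h.continuous.comp_aestronglyMeasurable (hU.aestronglyMeasurable.prodMk hV.aestronglyMeasurable)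
  refine MemLp.of_le_mul (c := 1) (g := fun ω => ‖G 0 0‖ + L * (‖U ω‖ + ‖V ω‖)) ?_ hmeas
    (ae_of_all _ fun ω => ?_)
  · have h1 : MemLp (fun ω => ‖U ω‖ + ‖V ω‖) 2 P := hU.norm.add hV.norm
    have h2 : MemLp (fun ω => L * (‖U ω‖ + ‖V ω‖)) 2 P := h1.const_mul L
    exact (memLp_const ‖G 0 0‖).add h2
  · rw [one_mul, Real.norm_of_nonneg (by positivity)]
    have h1 := h.norm_sub_le 0 0 (U ω) (V ω)
    rw [sub_zero, sub_zero] at h1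
    linarith [norm_le_norm_add_norm_sub' (G (U ω) (V ω)) (G 0 0)]

variable [IsProbabilityMeasure D] {U : Ω → Vec du} {V : Ω → Vec dv}
  {ζ : Ω → Ξ}

/-- Independence makes the joint law of point and sample a product, so Fubini freezes the point and
the variance bound at deterministic points applies uniformly. -/
theorem Oracle.noise_sq (h : Oracle g G D L σ) (hle : 𝓜 ≤ mΩ) (hU : Measurable[𝓜] U)
    (hV : Measurable[𝓜] V) (hζ : Measurable ζ) (hlaw : P.map ζ = D)
    (hind : Indep 𝓜 (MeasurableSpace.comap ζ inferInstance) P) :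
    Integrable (fun ω => ‖g (U ω) (V ω) (ζ ω) - G (U ω) (V ω)‖ ^ 2) P ∧
      ∫ ω, ‖g (U ω) (V ω) (ζ ω) - G (U ω) (V ω)‖ ^ 2 ∂P ≤ σ ^ 2 := by
  have hUV : Measurable[𝓜] fun ω => (U ω, V ω) := hU.prodMk hV
  have hUV' : Measurable fun ω => (U ω, V ω) := hUV.mono hle le_rfl
  have hmap := (indepFun_iff_map_prod_eq_prod_map_map hUV'.aemeasurable hζ.aemeasurable).1
    (indepFun_of_indep hUV hind)
  rw [hlaw] at hmap
  have hpair : Measurable fun ω => ((U ω, V ω), ζ ω) := hUV'.prodMk hζ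
  have : IsProbabilityMeasure (P.map fun ω => (U ω, V ω)) :=
    Measure.isProbabilityMeasure_map hUV'.aemeasurable
  let φ : (Vec du × Vec dv) × Ξ → ℝ := fun p => ‖g p.1.1 p.1.2 p.2 - G p.1.1 p.1.2‖ ^ 2
  have hφ : Measurable φ := h.measurable_noise.norm.pow_const 2
  have hbound : ∀ p : Vec du × Vec dv, ∫ ξ, φ (p, ξ) ∂D ≤ σ ^ 2 := fun p =>
    h.variance_le p.1 p.2
  have hprod : Integrable φ ((P.map fun ω => (U ω, V ω)).prod D) := by
    refine (integrable_prod_iff hφ.aestronglyMeasurable).2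
      ⟨ae_of_all _ fun p => h.integrable_sq p.1 p.2, ?_⟩
    refine Integrable.of_bound
      (hφ.norm.stronglyMeasurable.integral_prod_right').aestronglyMeasurable (σ ^ 2)
      (ae_of_all _ fun p => ?_)
    rw [Real.norm_of_nonneg (integral_nonneg fun _ => norm_nonneg _)]
    simpa [φ] using hbound p
  have hprod' := hprod
  rw [← hmap] at hprod'
  refine ⟨(integrable_map_measure hφ.aestronglyMeasurable hpair.aemeasurable).1 hprod', ?_⟩
  have h1 := integral_map (μ := P) hpair.aemeasurable (f := φ) hφ.aestronglyMeasurable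
  rw [hmap, integral_prod _ hprod] at h1
  refine h1.symm.trans_le ?_
  refine (integral_mono hprod.integral_prod_left (integrable_const (σ ^ 2)) hbound).trans_eq ?_
  simp

theorem Oracle.memLp_noise (h : Oracle g G D L σ) (hle : 𝓜 ≤ mΩ) (hU : Measurable[𝓜] U)
    (hV : Measurable[𝓜] V) (hζ : Measurable ζ) (hlaw : P.map ζ = D)
    (hind : Indep 𝓜 (MeasurableSpace.comap ζ inferInstance) P) :
    MemLp (fun ω => g (U ω) (V ω) (ζ ω) - G (U ω) (V ω)) 2 P := by
  refine (memLp_two_iff_integrable_sq_norm ?_).2 (h.noise_sq hle hU hV hζ hlaw hind).1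
  have hUV' : Measurable fun ω => (U ω, V ω) := (hU.prodMk hV).mono hle le_rfl
  exact (h.measurable_noise.comp (hUV'.prodMk hζ)).aestronglyMeasurable

/-- Fubini now freezes `Y` together with the point; the inner integral pairs a fixed vector with a
centred error and vanishes by unbiasedness. -/
theorem Oracle.integral_inner_noise (h : Oracle g G D L σ) (hle : 𝓜 ≤ mΩ)
    (hU : Measurable[𝓜] U) (hV : Measurable[𝓜] V) (hζ : Measurable ζ) (hlaw : P.map ζ = D)
    (hind : Indep 𝓜 (MeasurableSpace.comap ζ inferInstance) P)
    {Y : Ω → Vec d} (hY : Measurable[𝓜] Y) (hY2 : MemLp Y 2 P) :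
    ∫ ω, ⟪Y ω, g (U ω) (V ω) (ζ ω) - G (U ω) (V ω)⟫ ∂P = 0 := by
  have hX : Measurable[𝓜] fun ω => ((U ω, V ω), Y ω) := (hU.prodMk hV).prodMk hY
  have hX' : Measurable fun ω => ((U ω, V ω), Y ω) := hX.mono hle le_rfl
  have hmap := (indepFun_iff_map_prod_eq_prod_map_map hX'.aemeasurable hζ.aemeasurable).1
    (indepFun_of_indep hX hind)
  rw [hlaw] at hmap
  have hpair : Measurable fun ω => (((U ω, V ω), Y ω), ζ ω) := hX'.prodMk hζ
  let φ : ((Vec du × Vec dv) × Vec d) × Ξ → ℝ := fun p =>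
    ⟪p.1.2, g p.1.1.1 p.1.1.2 p.2 - G p.1.1.1 p.1.1.2⟫
  have hφ : Measurable φ := (measurable_snd.comp measurable_fst).inner
    (h.measurable_noise.comp ((measurable_fst.comp measurable_fst).prodMk measurable_snd))
  have hint : Integrable (fun ω => φ (((U ω, V ω), Y ω), ζ ω)) P :=
    integrable_inner_of_memLp_two hY2 (h.memLp_noise hle hU hV hζ hlaw hind)
  have hprod := (integrable_map_measure hφ.aestronglyMeasurable hpair.aemeasurable).2 hint
  have h1 := integral_map (μ := P) hpair.aemeasurable (f := φ) hφ.aestronglyMeasurable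
  rw [hmap] at hprod
  rw [hmap, integral_prod _ hprod] at h1
  refine h1.symm.trans ?_
  have : ∀ p : (Vec du × Vec dv) × Vec d, ∫ ξ, φ (p, ξ) ∂D = 0 := by
    intro p
    have hi : Integrable (fun ξ => g p.1.1 p.1.2 ξ - G p.1.1 p.1.2) D :=
      (h.integrable _ _).sub (integrable_const _)
    change ∫ ξ, ⟪p.2, g p.1.1 p.1.2 ξ - G p.1.1 p.1.2⟫ ∂D = 0
    rw [integral_inner hi, integral_sub (h.integrable _ _) (integrable_const _), h.integral_eq]
    simp
  simp [this]

end Oracle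

end FedAvgP

namespace FedAvgP

open scoped RealInnerProductSpace

/-! ### Accumulated oracle noise in one round -/

section Noise

variable {du dv d n : ℕ} {Ξ : Type*} [MeasurableSpace Ξ] {Ω : Type*} {mΩ : MeasurableSpace Ω}

/-- The error of the oracle `g` for `G i` at the point `p i k` with sample `ζ i k`. -/
def noise (g : Vec du → Vec dv → Ξ → Vec d) (G : Fin n → Vec du → Vec dv → Vec d)
    (p : Fin n → ℕ → Ω → Vec du × Vec dv) (ζ : Fin n → ℕ → Ω → Ξ) (i : Fin n) (k : ℕ) (ω : Ω) :
    Vec d :=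
  g (p i k ω).1 (p i k ω).2 (ζ i k ω) - G i (p i k ω).1 (p i k ω).2

/-- The samples `ζ i k ∼ D i` of one round are independent of everything else: `𝓜 i k` contains
all other samples of the round and all points that do not depend on `ζ i k`. -/
structure Adapted (P : Measure Ω) (D : Fin n → Measure Ξ) (ζ : Fin n → ℕ → Ω → Ξ)
    (p : Fin n → ℕ → Ω → Vec du × Vec dv) (𝓜 : Fin n → ℕ → MeasurableSpace Ω) : Prop where
  le : ∀ i k, 𝓜 i k ≤ mΩ
  indep : ∀ i k, Indep (𝓜 i k) (MeasurableSpace.comap (ζ i k) inferInstance) P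
  measurable_sample : ∀ i k, Measurable (ζ i k)
  law : ∀ i k, P.map (ζ i k) = D i
  measurable_other : ∀ i k j l, (j = i → l ≠ k) → Measurable[𝓜 i k] (ζ j l)
  measurable_point : ∀ i k j l, (j = i → l ≤ k) → Measurable[𝓜 i k] (p j l)

variable {P : Measure Ω} {D : Fin n → Measure Ξ} {ζ : Fin n → ℕ → Ω → Ξ}
  {p : Fin n → ℕ → Ω → Vec du × Vec dv} {𝓜 : Fin n → ℕ → MeasurableSpace Ω}
  {g : Vec du → Vec dv → Ξ → Vec d} {G : Fin n → Vec du → Vec dv → Vec d} {L σ : ℝ}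

namespace Adapted

theorem measurable_noise (h : Adapted P D ζ p 𝓜) (hg : ∀ i, Oracle g (G i) (D i) L σ)
    {i j : Fin n} {k l : ℕ} (hjl : j = i → l < k) :
    Measurable[𝓜 i k] (noise g G p ζ j l) :=
  (hg j).measurable_noise.comp ((h.measurable_point i k j l fun e => (hjl e).le).prodMk
    (h.measurable_other i k j l fun e => (hjl e).ne))

variable [IsProbabilityMeasure P] [∀ i, IsProbabilityMeasure (D i)]

theorem memLp_noise (h : Adapted P D ζ p 𝓜) (hg : ∀ i, Oracle g (G i) (D i) L σ) (i : Fin n)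
    (k : ℕ) : MemLp (noise g G p ζ i k) 2 P :=
  (hg i).memLp_noise (h.le i k) (h.measurable_point i k i k fun _ => le_rfl).fst
    (h.measurable_point i k i k fun _ => le_rfl).snd (h.measurable_sample i k) (h.law i k)
    (h.indep i k)

theorem integral_noise_sq_le (h : Adapted P D ζ p 𝓜) (hg : ∀ i, Oracle g (G i) (D i) L σ)
    (i : Fin n) (k : ℕ) : ∫ ω, ‖noise g G p ζ i k ω‖ ^ 2 ∂P ≤ σ ^ 2 :=
  ((hg i).noise_sq (h.le i k) (h.measurable_point i k i k fun _ => le_rfl).fst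
    (h.measurable_point i k i k fun _ => le_rfl).snd (h.measurable_sample i k) (h.law i k)
    (h.indep i k)).2

theorem integral_inner_noise (h : Adapted P D ζ p 𝓜) (hg : ∀ i, Oracle g (G i) (D i) L σ)
    (i : Fin n) (k : ℕ) {Y : Ω → Vec d} (hY : Measurable[𝓜 i k] Y) (hY2 : MemLp Y 2 P) :
    ∫ ω, ⟪Y ω, noise g G p ζ i k ω⟫ ∂P = 0 :=
  (hg i).integral_inner_noise (h.le i k) (h.measurable_point i k i k fun _ => le_rfl).fst
    (h.measurable_point i k i k fun _ => le_rfl).snd (h.measurable_sample i k) (h.law i k)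
    (h.indep i k) hY hY2

/-- Distinct errors are orthogonal. For two steps of one client, the earlier error is measurable for
the σ-algebra attached to the later sample; for two clients either order works, since `𝓜 i k`
contains all steps of the other clients. Hence only the squares survive. -/
theorem integral_norm_sum_noise_sq_le (h : Adapted P D ζ p 𝓜)
    (hg : ∀ i, Oracle g (G i) (D i) L σ) (A : Finset (Fin n)) (k : ℕ) :
    ∫ ω, ‖∑ i ∈ A, ∑ l ∈ Finset.range k, noise g G p ζ i l ω‖ ^ 2 ∂P ≤ A.card * k * σ ^ 2 := by
  have h1 := FedAvgP.integral_norm_sum_sq_le (P := P) (A ×ˢ Finset.range k)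
    (N := fun q => noise g G p ζ q.1 q.2) (v := σ ^ 2) (fun q _ => h.memLp_noise hg q.1 q.2)
    (fun q _ r _ hqr => ?_) (fun q _ => h.integral_noise_sq_le hg q.1 q.2)
  · simpa only [Finset.sum_product, Finset.card_product, Finset.card_range, Nat.cast_mul] using h1
  · by_cases hlt : q.1 = r.1 → q.2 < r.2
    · exact h.integral_inner_noise hg r.1 r.2 (h.measurable_noise hg hlt)
        (h.memLp_noise hg q.1 q.2)
    · push Not at hlt
      refine (integral_congr_ae (ae_of_all _ fun ω => real_inner_comm _ _)).trans
        (h.integral_inner_noise hg q.1 q.2 (h.measurable_noise hg fun _ => ?_)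
          (h.memLp_noise hg r.1 r.2))
      exact lt_of_le_of_ne hlt.2 fun e => hqr (Prod.ext hlt.1 e.symm)

/-- Mean squared displacement of an oracle descent path. -/
theorem integral_displacement_sq_le (h : Adapted P D ζ p 𝓜)
    (hg : ∀ i, Oracle g (G i) (D i) L σ) (i : Fin n)
    (hG : ∀ k, MemLp (fun ω => G i (p i k ω).1 (p i k ω).2) 2 P) (γ : ℝ) (k : ℕ) :
    ∫ ω, ‖γ • ∑ l ∈ Finset.range k, g (p i l ω).1 (p i l ω).2 (ζ i l ω)‖ ^ 2 ∂P
      ≤ 2 * γ ^ 2 * k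
        * (∑ l ∈ Finset.range k, ∫ ω, ‖G i (p i l ω).1 (p i l ω).2‖ ^ 2 ∂P + σ ^ 2) := by
  have hN : MemLp (fun ω => ∑ l ∈ Finset.range k, noise g G p ζ i l ω) 2 P :=
    memLp_finsetSum _ fun l _ => h.memLp_noise hg i l
  have hGi : ∀ l, Integrable (fun ω => ‖G i (p i l ω).1 (p i l ω).2‖ ^ 2) P := fun l =>
    (hG l).integrable_norm_pow two_ne_zero
  have hint : Integrable (fun ω => 2 * γ ^ 2 * (k * ∑ l ∈ Finset.range k,
      ‖G i (p i l ω).1 (p i l ω).2‖ ^ 2)) P :=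
    ((integrable_finsetSum _ fun l _ => hGi l).const_mul _).const_mul _
  have hint' : Integrable
      (fun ω => 2 * γ ^ 2 * ‖∑ l ∈ Finset.range k, noise g G p ζ i l ω‖ ^ 2) P :=
    (hN.integrable_norm_pow two_ne_zero).const_mul _
  have hpt : ∀ ω, ‖γ • ∑ l ∈ Finset.range k, g (p i l ω).1 (p i l ω).2 (ζ i l ω)‖ ^ 2
      ≤ 2 * γ ^ 2 * (k * ∑ l ∈ Finset.range k, ‖G i (p i l ω).1 (p i l ω).2‖ ^ 2)
        + 2 * γ ^ 2 * ‖∑ l ∈ Finset.range k, noise g G p ζ i l ω‖ ^ 2 := by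
    intro ω
    -- Exact gradients are separated from errors: Cauchy–Schwarz costs the former a factor `k`,
    -- while orthogonality bounds the latter by `k σ ^ 2` in total.
    have e : ∑ l ∈ Finset.range k, g (p i l ω).1 (p i l ω).2 (ζ i l ω)
        = ∑ l ∈ Finset.range k, G i (p i l ω).1 (p i l ω).2
          + ∑ l ∈ Finset.range k, noise g G p ζ i l ω := by
      rw [← Finset.sum_add_distrib]
      exact Finset.sum_congr rfl fun l _ => (add_sub_cancel _ _).symm
    have h1 : ‖∑ l ∈ Finset.range k, G i (p i l ω).1 (p i l ω).2‖ ^ 2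
        ≤ k * ∑ l ∈ Finset.range k, ‖G i (p i l ω).1 (p i l ω).2‖ ^ 2 := by
      refine (pow_le_pow_left₀ (norm_nonneg _) (norm_sum_le _ _) 2).trans ?_
      simpa using sq_sum_le_card_mul_sum_sq (s := Finset.range k)
        (f := fun l => ‖G i (p i l ω).1 (p i l ω).2‖)
    rw [norm_smul, mul_pow, Real.norm_eq_abs, sq_abs, e]
    have h2 := parallelogram_law_with_norm ℝ (∑ l ∈ Finset.range k, G i (p i l ω).1 (p i l ω).2)
      (∑ l ∈ Finset.range k, noise g G p ζ i l ω)
    have h3 := mul_nonneg (sq_nonneg γ) (sq_nonneg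
      ‖∑ l ∈ Finset.range k, G i (p i l ω).1 (p i l ω).2
        - ∑ l ∈ Finset.range k, noise g G p ζ i l ω‖)
    nlinarith [mul_le_mul_of_nonneg_left h1 (sq_nonneg γ)]
  refine (integral_mono_of_nonneg (ae_of_all _ fun ω => by positivity) (hint.add hint')
    (ae_of_all _ hpt)).trans ?_
  have h4 := h.integral_norm_sum_noise_sq_le hg {i} k
  simp only [Finset.sum_singleton, Finset.card_singleton, Nat.cast_one, one_mul] at h4
  simp only [Pi.add_apply]
  rw [integral_add hint hint', integral_const_mul, integral_const_mul, integral_const_mul,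
    integral_finsetSum _ fun l _ => hGi l]
  have h5 := mul_le_mul_of_nonneg_left h4 (show 0 ≤ 2 * γ ^ 2 by positivity)
  linarith

end Adapted

end Noise

end FedAvgP

namespace FedAvgP

open scoped RealInnerProductSpace

/-! ### Local steps and client drift -/

section LocalSteps

variable {du dv n : ℕ} {Ξ : Type*} {Ω : Type*}

/-- The stochastic gradient in the first block. -/
noncomputable def stochGradU (F : Vec du → Vec dv → Ξ → ℝ) (u : Vec du) (v : Vec dv) (ξ : Ξ) : Vec du :=
  gradU (sampleLoss F ξ) u v

/-- The stochastic gradient in the second block. -/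
noncomputable def stochGradV (F : Vec du → Vec dv → Ξ → ℝ) (u : Vec du) (v : Vec dv) (ξ : Ξ) : Vec dv :=
  gradV (sampleLoss F ξ) u v

/-- The `k`-th local point of client `i` in a round started at the random state `x`. -/
noncomputable def localPt (F : Vec du → Vec dv → Ξ → ℝ) (γu γv : ℝ) (ζ : Fin n → ℕ → Ω → Ξ)
    (x : Ω → Vec du × (Fin n → Vec dv)) (i : Fin n) (k : ℕ) (ω : Ω) : Vec du × Vec dv :=
  localIter F γu γv (fun l => ζ i l ω) (x ω).1 ((x ω).2 i) k

variable {F : Vec du → Vec dv → Ξ → ℝ} {γu γv : ℝ} {ζ : Fin n → ℕ → Ω → Ξ}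
  {x : Ω → Vec du × (Fin n → Vec dv)}

theorem localPt_fst (i : Fin n) (k : ℕ) (ω : Ω) :
    (localPt F γu γv ζ x i k ω).1 = (x ω).1 - γu • ∑ l ∈ Finset.range k,
      stochGradU F (localPt F γu γv ζ x i l ω).1 (localPt F γu γv ζ x i l ω).2 (ζ i l ω) := by
  induction k with
  | zero => simp [localPt, localIter]
  | succ k ih =>
    rw [Finset.sum_range_succ, smul_add, ← sub_sub, ← ih]
    rfl

theorem localPt_snd (i : Fin n) (k : ℕ) (ω : Ω) :
    (localPt F γu γv ζ x i k ω).2 = (x ω).2 i - γv • ∑ l ∈ Finset.range k,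
      stochGradV F (localPt F γu γv ζ x i l ω).1 (localPt F γu γv ζ x i l ω).2 (ζ i l ω) := by
  induction k with
  | zero => simp [localPt, localIter]
  | succ k ih =>
    rw [Finset.sum_range_succ, smul_add, ← sub_sub, ← ih]
    rfl

/-- Squared distance of the `k`-th local point from the start of the round. -/
noncomputable def localDist (F : Vec du → Vec dv → Ξ → ℝ) (γu γv : ℝ) (ζ : Fin n → ℕ → Ω → Ξ)
    (x : Ω → Vec du × (Fin n → Vec dv)) (i : Fin n) (k : ℕ) (ω : Ω) : ℝ :=
  ‖(localPt F γu γv ζ x i k ω).1 - (x ω).1‖ ^ 2 + ‖(localPt F γu γv ζ x i k ω).2 - (x ω).2 i‖ ^ 2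

theorem localDist_nonneg (i : Fin n) (k : ℕ) (ω : Ω) : 0 ≤ localDist F γu γv ζ x i k ω := by
  unfold localDist
  positivity

/-- Only samples strictly before step `k` enter the `k`-th point. This is what makes the point
independent of the sample used there. -/
theorem measurable_localPt [MeasurableSpace Ξ] {𝓜 : MeasurableSpace Ω}
    (hFu : Measurable fun p : (Vec du × Vec dv) × Ξ => stochGradU F p.1.1 p.1.2 p.2)
    (hFv : Measurable fun p : (Vec du × Vec dv) × Ξ => stochGradV F p.1.1 p.1.2 p.2)
    (hx : Measurable x) (i : Fin n) (k : ℕ) (hζ : ∀ l < k, Measurable (ζ i l)) :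
    Measurable (localPt F γu γv ζ x i k) := by
  induction k with
  | zero => exact hx.fst.prodMk ((measurable_pi_apply i).comp hx.snd)
  | succ k ih =>
    have h := ih fun l hl => hζ l (hl.trans k.lt_succ_self)
    have hp := h.prodMk (hζ k k.lt_succ_self)
    exact (h.fst.sub ((hFu.comp hp).const_smul γu)).prodMk
      (h.snd.sub ((hFv.comp hp).const_smul γv))

variable [MeasurableSpace Ξ] {mΩ : MeasurableSpace Ω}

/-- Standing facts about one round started at the random state `x` with fresh samples `ζ`. -/
structure RoundModel (P : Measure Ω) (F : Vec du → Vec dv → Ξ → ℝ) (D : Fin n → Measure Ξ)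
    (L σu σv γu γv : ℝ) (ζ : Fin n → ℕ → Ω → Ξ) (x : Ω → Vec du × (Fin n → Vec dv))
    (𝓜 : Fin n → ℕ → MeasurableSpace Ω) : Prop where
  smooth : ∀ i, BlockSmooth (clientObj F D i) L
  oracle_u : ∀ i, Oracle (stochGradU F) (gradU (clientObj F D i)) (D i) L σu
  oracle_v : ∀ i, Oracle (stochGradV F) (gradV (clientObj F D i)) (D i) L σv
  adapted : Adapted P D ζ (localPt F γu γv ζ x) 𝓜
  memLp_u : MemLp (fun ω => (x ω).1) 2 P
  memLp_v : ∀ i, MemLp (fun ω => (x ω).2 i) 2 P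

namespace RoundModel

variable {P : Measure Ω} [IsProbabilityMeasure P] {D : Fin n → Measure Ξ}
  [∀ i, IsProbabilityMeasure (D i)] {𝓜 : Fin n → ℕ → MeasurableSpace Ω} {L σu σv : ℝ}

/-- A Lipschitz gradient field has linear growth and the noise has finite variance, so each local
step preserves square integrability. -/
theorem memLp_localPt (h : RoundModel P F D L σu σv γu γv ζ x 𝓜) (i : Fin n) (k : ℕ) :
    MemLp (fun ω => (localPt F γu γv ζ x i k ω).1) 2 P ∧
      MemLp (fun ω => (localPt F γu γv ζ x i k ω).2) 2 P := by
  induction k with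
  | zero => exact ⟨h.memLp_u, h.memLp_v i⟩
  | succ k ih =>
    have hu := ((h.oracle_u i).memLp_mean (h.smooth i).nonneg ih.1 ih.2).add
      (h.adapted.memLp_noise h.oracle_u i k)
    have hv := ((h.oracle_v i).memLp_mean (h.smooth i).nonneg ih.1 ih.2).add
      (h.adapted.memLp_noise h.oracle_v i k)
    refine ⟨(ih.1.sub (hu.const_smul γu)).ae_eq (ae_of_all _ fun ω => ?_),
      (ih.2.sub (hv.const_smul γv)).ae_eq (ae_of_all _ fun ω => ?_)⟩
    · simp only [Pi.sub_apply, Pi.smul_apply, Pi.add_apply, noise, add_sub_cancel]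
      rfl
    · simp only [Pi.sub_apply, Pi.smul_apply, Pi.add_apply, noise, add_sub_cancel]
      rfl

theorem memLp_gradU (h : RoundModel P F D L σu σv γu γv ζ x 𝓜) (i : Fin n) (k : ℕ) :
    MemLp (fun ω => gradU (clientObj F D i) (localPt F γu γv ζ x i k ω).1
      (localPt F γu γv ζ x i k ω).2) 2 P :=
  (h.oracle_u i).memLp_mean (h.smooth i).nonneg (h.memLp_localPt i k).1 (h.memLp_localPt i k).2

theorem memLp_gradV (h : RoundModel P F D L σu σv γu γv ζ x 𝓜) (i : Fin n) (k : ℕ) :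
    MemLp (fun ω => gradV (clientObj F D i) (localPt F γu γv ζ x i k ω).1
      (localPt F γu γv ζ x i k ω).2) 2 P :=
  (h.oracle_v i).memLp_mean (h.smooth i).nonneg (h.memLp_localPt i k).1 (h.memLp_localPt i k).2

theorem memLp_gradU_start (h : RoundModel P F D L σu σv γu γv ζ x 𝓜) (i : Fin n) :
    MemLp (fun ω => gradU (clientObj F D i) (x ω).1 ((x ω).2 i)) 2 P :=
  h.memLp_gradU i 0

theorem memLp_gradV_start (h : RoundModel P F D L σu σv γu γv ζ x 𝓜) (i : Fin n) :
    MemLp (fun ω => gradV (clientObj F D i) (x ω).1 ((x ω).2 i)) 2 P :=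
  h.memLp_gradV i 0

end RoundModel

theorem Oracle.norm_sub_sq_le {d : ℕ} {g : Vec du → Vec dv → Ξ → Vec d}
    {G : Vec du → Vec dv → Vec d} {D : Measure Ξ} {L σ : ℝ} (h : Oracle g G D L σ) (i : Fin n)
    (k : ℕ) (ω : Ω) :
    ‖G (localPt F γu γv ζ x i k ω).1 (localPt F γu γv ζ x i k ω).2 - G (x ω).1 ((x ω).2 i)‖ ^ 2
      ≤ 2 * L ^ 2 * localDist F γu γv ζ x i k ω := by
  refine (pow_le_pow_left₀ (norm_nonneg _) (h.norm_sub_le _ _ _ _) 2).trans ?_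
  rw [mul_pow, localDist]
  nlinarith [mul_nonneg (sq_nonneg L) (sq_nonneg
    (‖(localPt F γu γv ζ x i k ω).1 - (x ω).1‖ - ‖(localPt F γu γv ζ x i k ω).2 - (x ω).2 i‖))]

namespace RoundModel

variable {P : Measure Ω} [IsProbabilityMeasure P] {D : Fin n → Measure Ξ}
  [∀ i, IsProbabilityMeasure (D i)] {𝓜 : Fin n → ℕ → MeasurableSpace Ω} {L σu σv : ℝ}

theorem integrable_localDist (h : RoundModel P F D L σu σv γu γv ζ x 𝓜) (i : Fin n) (k : ℕ) :
    Integrable (localDist F γu γv ζ x i k) P :=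
  (((h.memLp_localPt i k).1.sub h.memLp_u).integrable_norm_pow two_ne_zero).add
    (((h.memLp_localPt i k).2.sub (h.memLp_v i)).integrable_norm_pow two_ne_zero)

theorem integral_norm_sq_localPt_le {d : ℕ} {g : Vec du → Vec dv → Ξ → Vec d}
    {G : Fin n → Vec du → Vec dv → Vec d} {σ : ℝ}
    (h : RoundModel P F D L σu σv γu γv ζ x 𝓜) (hg : ∀ i, Oracle g (G i) (D i) L σ)
    (i : Fin n) (k : ℕ) :
    ∫ ω, ‖G i (localPt F γu γv ζ x i k ω).1 (localPt F γu γv ζ x i k ω).2‖ ^ 2 ∂P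
      ≤ 2 * ∫ ω, ‖G i (x ω).1 ((x ω).2 i)‖ ^ 2 ∂P
        + 4 * L ^ 2 * ∫ ω, localDist F γu γv ζ x i k ω ∂P := by
  have h0 : Integrable (fun ω => 2 * ‖G i (x ω).1 ((x ω).2 i)‖ ^ 2) P :=
    (((hg i).memLp_mean (h.smooth i).nonneg h.memLp_u (h.memLp_v i)).integrable_norm_pow
      two_ne_zero).const_mul 2
  have h1 : Integrable (fun ω => 4 * L ^ 2 * localDist F γu γv ζ x i k ω) P :=
    (h.integrable_localDist i k).const_mul _
  rw [← integral_const_mul, ← integral_const_mul, ← integral_add h0 h1]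
  refine integral_mono_of_nonneg (ae_of_all _ fun ω => by positivity) (h0.add h1)
    (ae_of_all _ fun ω => ?_)
  have h2 := (hg i).norm_sub_sq_le (F := F) (γu := γu) (γv := γv) (ζ := ζ) (x := x) i k ω
  set y := G i (localPt F γu γv ζ x i k ω).1 (localPt F γu γv ζ x i k ω).2
  set z := G i (x ω).1 ((x ω).2 i)
  have h3 := parallelogram_law_with_norm ℝ (y - z) z
  rw [sub_add_cancel] at h3
  change ‖y‖ ^ 2 ≤ 2 * ‖z‖ ^ 2 + 4 * L ^ 2 * localDist F γu γv ζ x i k ω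
  nlinarith [sq_nonneg ‖y - z - z‖]

/-- Bound of the client drift accumulated over `K` local steps. -/
theorem sum_integral_localDist_le (h : RoundModel P F D L σu σv γu γv ζ x 𝓜) {K : ℕ}
    (hK : 1 ≤ K) {γ : ℝ} (hγL : 32 * L * K * γ ≤ 1) (hγu : γu ^ 2 ≤ γ ^ 2)
    (hγv : γv ^ 2 ≤ γ ^ 2) (hγ : 0 < γ) (i : Fin n) :
    ∑ k ∈ Finset.range K, ∫ ω, localDist F γu γv ζ x i k ω ∂P
      ≤ 3 * K ^ 2 * (K - 1) * (γu ^ 2 * ∫ ω, ‖gradU (clientObj F D i) (x ω).1 ((x ω).2 i)‖ ^ 2 ∂P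
          + γv ^ 2 * ∫ ω, ‖gradV (clientObj F D i) (x ω).1 ((x ω).2 i)‖ ^ 2 ∂P)
        + 2 * K * (K - 1) * (γu ^ 2 * σu ^ 2 + γv ^ 2 * σv ^ 2) := by
  set W : ℕ → ℝ := fun k => ∫ ω, localDist F γu γv ζ x i k ω ∂P with hW
  set Wt := ∑ k ∈ Finset.range K, W k with hWt
  set gu := ∫ ω, ‖gradU (clientObj F D i) (x ω).1 ((x ω).2 i)‖ ^ 2 ∂P with hgu
  set gv := ∫ ω, ‖gradV (clientObj F D i) (x ω).1 ((x ω).2 i)‖ ^ 2 ∂P with hgv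
  have hK1 : (1 : ℝ) ≤ K := by exact_mod_cast hK
  have hL := (h.smooth i).nonneg
  have hW0 : ∀ k, 0 ≤ W k := fun k => integral_nonneg fun ω => localDist_nonneg i k ω
  have hWt0 : 0 ≤ Wt := Finset.sum_nonneg fun k _ => hW0 k
  have hgu0 : 0 ≤ gu := integral_nonneg fun ω => by positivity
  have hgv0 : 0 ≤ gv := integral_nonneg fun ω => by positivity
  have hpart : ∀ k ≤ K, ∀ c : ℝ, 0 ≤ c → ∑ l ∈ Finset.range k, (2 * c + 4 * L ^ 2 * W l)
      ≤ 2 * K * c + 4 * L ^ 2 * Wt := by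
    intro k hk c hc
    refine (Finset.sum_le_sum_of_subset_of_nonneg (Finset.range_mono hk)
      fun l _ _ => by have := hW0 l; positivity).trans_eq ?_
    rw [Finset.sum_add_distrib, Finset.sum_const, Finset.card_range, nsmul_eq_mul,
      ← Finset.mul_sum]
    ring
  -- `R` contains the total drift `Wt` itself: the bound `W k ≤ 2 R k`, summed over `k`, becomes an
  -- inequality to be solved for `Wt`.
  set R := γu ^ 2 * (2 * K * gu + 4 * L ^ 2 * Wt + σu ^ 2)
    + γv ^ 2 * (2 * K * gv + 4 * L ^ 2 * Wt + σv ^ 2) with hR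
  have hstep : ∀ k ∈ Finset.range K, W k ≤ 2 * R * k := by
    intro k hk
    have hkK : k ≤ K := (Finset.mem_range.1 hk).le
    have hu := h.adapted.integral_displacement_sq_le h.oracle_u i (h.memLp_gradU i) γu k
    have hv := h.adapted.integral_displacement_sq_le h.oracle_v i (h.memLp_gradV i) γv k
    have hsu := (Finset.sum_le_sum fun l _ =>
      h.integral_norm_sq_localPt_le h.oracle_u i l).trans (hpart k hkK gu hgu0)
    have hsv := (Finset.sum_le_sum fun l _ =>
      h.integral_norm_sq_localPt_le h.oracle_v i l).trans (hpart k hkK gv hgv0)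
    have hWk : W k = ∫ ω, ‖γu • ∑ l ∈ Finset.range k, stochGradU F
          (localPt F γu γv ζ x i l ω).1 (localPt F γu γv ζ x i l ω).2 (ζ i l ω)‖ ^ 2 ∂P
        + ∫ ω, ‖γv • ∑ l ∈ Finset.range k, stochGradV F
          (localPt F γu γv ζ x i l ω).1 (localPt F γu γv ζ x i l ω).2 (ζ i l ω)‖ ^ 2 ∂P := by
      have e1 : ∀ ω, ‖(localPt F γu γv ζ x i k ω).1 - (x ω).1‖ ^ 2
          = ‖γu • ∑ l ∈ Finset.range k, stochGradU F (localPt F γu γv ζ x i l ω).1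
            (localPt F γu γv ζ x i l ω).2 (ζ i l ω)‖ ^ 2 := fun ω => by
        rw [localPt_fst, sub_sub_cancel_left, norm_neg]
      have e2 : ∀ ω, ‖(localPt F γu γv ζ x i k ω).2 - (x ω).2 i‖ ^ 2
          = ‖γv • ∑ l ∈ Finset.range k, stochGradV F (localPt F γu γv ζ x i l ω).1
            (localPt F γu γv ζ x i l ω).2 (ζ i l ω)‖ ^ 2 := fun ω => by
        rw [localPt_snd, sub_sub_cancel_left, norm_neg]
      rw [hW]
      simp only [localDist]
      have i1 : Integrable (fun ω => ‖(localPt F γu γv ζ x i k ω).1 - (x ω).1‖ ^ 2) P :=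
        ((h.memLp_localPt i k).1.sub h.memLp_u).integrable_norm_pow two_ne_zero
      have i2 : Integrable (fun ω => ‖(localPt F γu γv ζ x i k ω).2 - (x ω).2 i‖ ^ 2) P :=
        ((h.memLp_localPt i k).2.sub (h.memLp_v i)).integrable_norm_pow two_ne_zero
      rw [integral_add i1 i2]
      simp only [e1, e2]
    rw [hWk]
    have hu' := hu.trans (mul_le_mul_of_nonneg_left (add_le_add_left hsu (σu ^ 2))
      (by positivity))
    have hv' := hv.trans (mul_le_mul_of_nonneg_left (add_le_add_left hsv (σv ^ 2))
      (by positivity))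
    refine (add_le_add hu' hv').trans_eq ?_
    rw [hR]
    ring
  have hgauss : ∀ N : ℕ, ∑ k ∈ Finset.range N, (k : ℝ) = N * (N - 1) / 2 := by
    intro N
    induction N with
    | zero => simp
    | succ N ih => rw [Finset.sum_range_succ, ih]; push_cast; ring
  have htot : Wt ≤ K * (K - 1) * R := by
    refine (Finset.sum_le_sum hstep).trans_eq ?_
    rw [← Finset.mul_sum, hgauss]
    ring
  have hKK : (0 : ℝ) ≤ K * (K - 1) := mul_nonneg (by linarith) (by linarith)
  -- From `L K γ ≤ 1 / 32` the left side is at most `8 (L K γ) ^ 2 ≤ 8 / 1024`.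
  have hsmall : (K : ℝ) * (K - 1) * (4 * L ^ 2 * (γu ^ 2 + γv ^ 2)) ≤ 1 / 128 := by
    have h1 : (L * K * γ) ^ 2 ≤ (1 / 32) ^ 2 :=
      pow_le_pow_left₀ (by positivity) (by linarith) 2
    have h2 : (K : ℝ) * (K - 1) * (4 * L ^ 2 * (γu ^ 2 + γv ^ 2))
        ≤ K ^ 2 * (4 * L ^ 2 * (γ ^ 2 + γ ^ 2)) := by
      refine mul_le_mul (by nlinarith) ?_ (by positivity) (by positivity)
      gcongr
    nlinarith
  have hmain : Wt ≤ K * (K - 1) * (2 * K * (γu ^ 2 * gu + γv ^ 2 * gv)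
      + (γu ^ 2 * σu ^ 2 + γv ^ 2 * σv ^ 2)) + 1 / 128 * Wt := by
    have h1 := mul_le_mul_of_nonneg_right hsmall hWt0
    rw [hR] at htot
    linarith
  -- Solving for `Wt` multiplies by `128 / 127`. The coefficients `2` and `1` are then rounded up to
  -- `3` and `2`, and the slack is nonnegative by these two facts.
  have h3 : 0 ≤ K * (K - 1) * (K * (γu ^ 2 * gu + γv ^ 2 * gv)) :=
    mul_nonneg hKK (by positivity)
  have h4 : 0 ≤ K * (K - 1) * (γu ^ 2 * σu ^ 2 + γv ^ 2 * σv ^ 2) :=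
    mul_nonneg hKK (by positivity)
  linarith

end RoundModel

end LocalSteps

end FedAvgP

namespace FedAvgP

open scoped RealInnerProductSpace

/-! ### Splitting a round into signal and noise -/

section Round

variable {du dv n : ℕ} {Ξ : Type*} {Ω : Type*} {F : Vec du → Vec dv → Ξ → ℝ}

variable {γu γv ηu ηv : ℝ} {m K : ℕ}

theorem fedRound_fst (hm : 1 ≤ m) {A : Finset (Fin n)} (hA : A.card = m)
    (ζ : Fin n → ℕ → Ω → Ξ) (x : Ω → Vec du × (Fin n → Vec dv)) (ω : Ω) :
    (fedRound F γu γv ηu ηv m K A (fun i k => ζ i k ω) (x ω)).1 - (x ω).1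
      = -(γu * ηu / m) • ∑ i ∈ A, ∑ k ∈ Finset.range K, stochGradU F
        (localPt F γu γv ζ x i k ω).1 (localPt F γu γv ζ x i k ω).2 (ζ i k ω) := by
  have hm' : (m : ℝ) ≠ 0 := by exact_mod_cast (by omega : m ≠ 0)
  have h1 : ∑ i ∈ A, (localIter F γu γv (fun k => ζ i k ω) (x ω).1 ((x ω).2 i) K).1
      = ∑ i ∈ A, ((x ω).1 - γu • ∑ k ∈ Finset.range K, stochGradU F
        (localPt F γu γv ζ x i k ω).1 (localPt F γu γv ζ x i k ω).2 (ζ i k ω)) :=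
    Finset.sum_congr rfl fun i _ => localPt_fst i K ω
  rw [fedRound, h1, Finset.sum_sub_distrib, Finset.sum_const, hA, ← Finset.smul_sum,
    ← Nat.cast_smul_eq_nsmul ℝ, smul_sub, smul_smul, smul_smul, div_mul_cancel₀ _ hm']
  module

theorem fedRound_snd (A : Finset (Fin n)) (ζ : Fin n → ℕ → Ω → Ξ)
    (x : Ω → Vec du × (Fin n → Vec dv)) (i : Fin n) (ω : Ω) :
    (fedRound F γu γv ηu ηv m K A (fun i k => ζ i k ω) (x ω)).2 i - (x ω).2 i
      = if i ∈ A then -(γv * ηv) • ∑ k ∈ Finset.range K, stochGradV F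
        (localPt F γu γv ζ x i k ω).1 (localPt F γu γv ζ x i k ω).2 (ζ i k ω) else 0 := by
  have h1 : (localIter F γu γv (fun k => ζ i k ω) (x ω).1 ((x ω).2 i) K).2
      = (x ω).2 i - γv • ∑ k ∈ Finset.range K, stochGradV F
        (localPt F γu γv ζ x i k ω).1 (localPt F γu γv ζ x i k ω).2 (ζ i k ω) :=
    localPt_snd i K ω
  by_cases hi : i ∈ A
  · simp only [fedRound, hi, if_true, h1]
    module
  · simp [fedRound, hi]

variable {L : ℝ}

/-- The first- and second-order terms of a round in which the clients `A` take part, moving along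
the vectors `a i` and `c i`. -/
noncomputable def roundTerm (L γ : ℝ) (m : ℕ) {E E' : Type*} [NormedAddCommGroup E]
    [InnerProductSpace ℝ E] [NormedAddCommGroup E'] [InnerProductSpace ℝ E'] (g : E)
    (q : Fin n → E') (a : Fin n → E) (c : Fin n → E') (A : Finset (Fin n)) : ℝ :=
  -(γ / m) * ∑ i ∈ A, ⟪g, a i⟫ + 2 * L * γ ^ 2 / m ^ 2 * ‖∑ i ∈ A, a i‖ ^ 2
    + 1 / n * ∑ i ∈ A, (-γ * ⟪q i, c i⟫ + 2 * L * γ ^ 2 * ‖c i‖ ^ 2)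

theorem mul_norm_neg_smul_add_sq_le {E : Type*} [NormedAddCommGroup E] [InnerProductSpace ℝ E]
    (hL : 0 ≤ L) (r : ℝ) (y z : E) :
    L * ‖-r • (y + z)‖ ^ 2 ≤ 2 * L * r ^ 2 * ‖y‖ ^ 2 + 2 * L * r ^ 2 * ‖z‖ ^ 2 := by
  have h := parallelogram_law_with_norm ℝ y z
  rw [norm_smul, mul_pow, Real.norm_eq_abs, sq_abs, neg_sq]
  have h1 := mul_nonneg (mul_nonneg hL (sq_nonneg r)) (sq_nonneg ‖y - z‖)
  have h2 : ‖y + z‖ ^ 2 = 2 * (‖y‖ ^ 2 + ‖z‖ ^ 2) - ‖y - z‖ ^ 2 := by linarith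
  rw [h2]
  linarith

/-- The linear parts split exactly. The exact gradients depend on earlier errors, so the cross terms
of the squares need not have mean zero; `‖y + z‖ ^ 2 ≤ 2 ‖y‖ ^ 2 + 2 ‖z‖ ^ 2` removes them, which is
why `roundTerm` carries `2 * L`. -/
theorem inner_add_norm_sq_le_roundTerm {E E' : Type*} [NormedAddCommGroup E]
    [InnerProductSpace ℝ E] [NormedAddCommGroup E'] [InnerProductSpace ℝ E'] {γ : ℝ} (hL : 0 ≤ L)
    (g : E) (q : Fin n → E') (a N : Fin n → E) (c M : Fin n → E') (A : Finset (Fin n)) :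
    ⟪g, -(γ / m) • ∑ i ∈ A, (a i + N i)⟫ + L * ‖-(γ / m) • ∑ i ∈ A, (a i + N i)‖ ^ 2
      + 1 / n * ∑ i, (⟪q i, if i ∈ A then -γ • (c i + M i) else 0⟫
        + L * ‖if i ∈ A then -γ • (c i + M i) else 0‖ ^ 2)
      ≤ roundTerm L γ m g q a c A + roundTerm L γ m g q N M A := by
  have h1 := mul_norm_neg_smul_add_sq_le hL (γ / m) (∑ i ∈ A, a i) (∑ i ∈ A, N i)
  have h2 : ∑ i, (⟪q i, if i ∈ A then -γ • (c i + M i) else 0⟫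
        + L * ‖if i ∈ A then -γ • (c i + M i) else 0‖ ^ 2)
      ≤ ∑ i ∈ A, (-γ * ⟪q i, c i⟫ + 2 * L * γ ^ 2 * ‖c i‖ ^ 2)
        + ∑ i ∈ A, (-γ * ⟪q i, M i⟫ + 2 * L * γ ^ 2 * ‖M i‖ ^ 2) := by
    rw [← Finset.sum_add_distrib]
    have : ∀ i, (⟪q i, if i ∈ A then -γ • (c i + M i) else 0⟫
        + L * ‖if i ∈ A then -γ • (c i + M i) else 0‖ ^ 2)
        = if i ∈ A then ⟪q i, -γ • (c i + M i)⟫ + L * ‖-γ • (c i + M i)‖ ^ 2 else 0 := by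
      intro i
      split_ifs <;> simp
    simp only [this, Finset.sum_ite_mem, Finset.univ_inter]
    refine Finset.sum_le_sum fun i _ => ?_
    have := mul_norm_neg_smul_add_sq_le hL γ (c i) (M i)
    rw [inner_smul_right, inner_add_right]
    linarith
  have h3 := mul_le_mul_of_nonneg_left h2 (show 0 ≤ 1 / (n : ℝ) by positivity)
  have e1 : 2 * L * (γ / m) ^ 2 = 2 * L * γ ^ 2 / m ^ 2 := by ring
  rw [e1] at h1
  rw [Finset.sum_add_distrib, roundTerm, roundTerm, inner_smul_right, inner_add_right, inner_sum,
    inner_sum]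
  linarith

variable [MeasurableSpace Ξ] {D : Fin n → Measure Ξ} {mΩ : MeasurableSpace Ω} {P : Measure Ω}

theorem globalObj_le (hF : ∀ i, BlockSmooth (clientObj F D i) L) (hn : 1 ≤ n) (u u' : Vec du)
    (v v' : Fin n → Vec dv) :
    globalObj F D u' v' ≤ globalObj F D u v
      + ⟪(1 / (n : ℝ)) • ∑ i, gradU (clientObj F D i) u (v i), u' - u⟫ + L * ‖u' - u‖ ^ 2
      + 1 / n * ∑ i, (⟪gradV (clientObj F D i) u (v i), v' i - v i⟫ + L * ‖v' i - v i‖ ^ 2) := by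
  have hn' : (n : ℝ) ≠ 0 := by exact_mod_cast (by omega : n ≠ 0)
  have h1 : ∀ i, clientObj F D i u' (v' i) ≤ clientObj F D i u (v i)
      + ⟪gradU (clientObj F D i) u (v i), u' - u⟫ + L * ‖u' - u‖ ^ 2
      + (⟪gradV (clientObj F D i) u (v i), v' i - v i⟫ + L * ‖v' i - v i‖ ^ 2) := by
    intro i
    have := (abs_le.1 ((hF i).abs_sub_le u u' (v i) (v' i))).2
    linarith
  have h2 := mul_le_mul_of_nonneg_left (Finset.sum_le_sum fun i (_ : i ∈ Finset.univ) => h1 i)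
    (show 0 ≤ 1 / (n : ℝ) by positivity)
  refine h2.trans_eq ?_
  simp only [globalObj, Finset.sum_add_distrib, Finset.sum_const, Finset.card_univ,
    Fintype.card_fin, nsmul_eq_mul, real_inner_smul_left, sum_inner]
  field_simp

theorem continuous_globalObj (hF : ∀ i, BlockSmooth (clientObj F D i) L) :
    Continuous fun p : Vec du × (Fin n → Vec dv) => globalObj F D p.1 p.2 :=
  continuous_const.mul (continuous_finsetSum _ fun i _ => (hF i).continuous.comp
    (continuous_fst.prodMk ((continuous_apply i).comp continuous_snd)))

theorem integrable_roundTerm {E E' : Type*} [NormedAddCommGroup E] [InnerProductSpace ℝ E]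
    [NormedAddCommGroup E'] [InnerProductSpace ℝ E'] {γ : ℝ} {g : Ω → E} {q : Fin n → Ω → E'}
    {a : Fin n → Ω → E} {c : Fin n → Ω → E'} (hg : MemLp g 2 P) (hq : ∀ i, MemLp (q i) 2 P)
    (ha : ∀ i, MemLp (a i) 2 P) (hc : ∀ i, MemLp (c i) 2 P) (A : Finset (Fin n)) :
    Integrable (fun ω => roundTerm L γ m (g ω) (fun i => q i ω) (fun i => a i ω)
      (fun i => c i ω) A) P := by
  have h1 : Integrable (fun ω => ∑ i ∈ A, ⟪g ω, a i ω⟫) P :=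
    integrable_finsetSum _ fun i _ => integrable_inner_of_memLp_two hg (ha i)
  have h2 : Integrable (fun ω => ‖∑ i ∈ A, a i ω‖ ^ 2) P :=
    (memLp_finsetSum _ fun i _ => ha i).integrable_norm_pow two_ne_zero
  have h3 : Integrable (fun ω => ∑ i ∈ A, (-γ * ⟪q i ω, c i ω⟫
      + 2 * L * γ ^ 2 * ‖c i ω‖ ^ 2)) P :=
    integrable_finsetSum _ fun i _ => ((integrable_inner_of_memLp_two (hq i) (hc i)).const_mul
      _).add (((hc i).integrable_norm_pow two_ne_zero).const_mul _)
  exact ((h1.const_mul _).add (h2.const_mul _)).add (h3.const_mul _)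

variable [IsProbabilityMeasure P]

/-- The expansion at the origin bounds `f` by a constant, linear terms and squares, all integrable.
-/
theorem BlockSmooth.integrable {f : Vec du → Vec dv → ℝ} (hf : BlockSmooth f L)
    {U : Ω → Vec du} {V : Ω → Vec dv} (hU : MemLp U 2 P) (hV : MemLp V 2 P) :
    Integrable (fun ω => f (U ω) (V ω)) P := by
  have hmeas : AEStronglyMeasurable (fun ω => f (U ω) (V ω)) P :=
    hf.continuous.comp_aestronglyMeasurable (hU.aestronglyMeasurable.prodMk hV.aestronglyMeasurable)
  have h1 : Integrable (fun ω => L * (‖U ω‖ ^ 2 + ‖V ω‖ ^ 2)) P :=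
    ((hU.integrable_norm_pow two_ne_zero).add (hV.integrable_norm_pow two_ne_zero)).const_mul L
  have h2 : Integrable (fun ω => ⟪gradU f 0 0, U ω⟫) P :=
    integrable_inner_of_memLp_two (memLp_const _) hU
  have h3 : Integrable (fun ω => ⟪gradV f 0 0, V ω⟫) P :=
    integrable_inner_of_memLp_two (memLp_const _) hV
  refine ((((integrable_const |f 0 0|).add h2.abs).add h3.abs).add h1).mono' hmeas
    (ae_of_all _ fun ω => ?_)
  have h := hf.abs_sub_le 0 (U ω) 0 (V ω)
  rw [sub_zero, sub_zero] at h
  simp only [Pi.add_apply, Real.norm_eq_abs]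
  rw [abs_le] at h ⊢
  have b1 := abs_le.1 (le_refl |f 0 0|)
  have b2 := abs_le.1 (le_refl |⟪gradU f 0 0, U ω⟫|)
  have b3 := abs_le.1 (le_refl |⟪gradV f 0 0, V ω⟫|)
  constructor <;> linarith [h.1, h.2, b1.1, b1.2, b2.1, b2.2, b3.1, b3.2]

theorem integrable_globalObj (hF : ∀ i, BlockSmooth (clientObj F D i) L)
    {y : Ω → Vec du × (Fin n → Vec dv)} (hu : MemLp (fun ω => (y ω).1) 2 P)
    (hv : ∀ i, MemLp (fun ω => (y ω).2 i) 2 P) :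
    Integrable (fun ω => globalObj F D (y ω).1 (y ω).2) P :=
  (integrable_finsetSum _ fun i _ => (hF i).integrable hu (hv i)).const_mul _

end Round

end FedAvgP

namespace FedAvgP

open scoped RealInnerProductSpace

/-! ### Expected change of the objective for a fixed client set -/

section OneRound

variable {du dv n : ℕ} {Ξ : Type*} {Ω : Type*} {ζ : Fin n → ℕ → Ω → Ξ} {K : ℕ}

/-- Sum of the vector fields `G i` along the first `K` points of client `i`. -/
noncomputable def fieldSum {d : ℕ} (G : Fin n → Vec du → Vec dv → Vec d)
    (p : Fin n → ℕ → Ω → Vec du × Vec dv) (K : ℕ) (i : Fin n) (ω : Ω) : Vec d :=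
  ∑ k ∈ Finset.range K, G i (p i k ω).1 (p i k ω).2

/-- Sum of the oracle errors along the first `K` points of client `i`. -/
noncomputable def noiseSum {d : ℕ} (g : Vec du → Vec dv → Ξ → Vec d)
    (G : Fin n → Vec du → Vec dv → Vec d) (p : Fin n → ℕ → Ω → Vec du × Vec dv)
    (ζ : Fin n → ℕ → Ω → Ξ) (K : ℕ) (i : Fin n) (ω : Ω) : Vec d :=
  ∑ k ∈ Finset.range K, noise g G p ζ i k ω

theorem sum_oracle_eq {d : ℕ} (g : Vec du → Vec dv → Ξ → Vec d)
    (G : Fin n → Vec du → Vec dv → Vec d) (p : Fin n → ℕ → Ω → Vec du × Vec dv) (i : Fin n)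
    (ω : Ω) : ∑ k ∈ Finset.range K, g (p i k ω).1 (p i k ω).2 (ζ i k ω)
      = fieldSum G p K i ω + noiseSum g G p ζ K i ω := by
  rw [fieldSum, noiseSum, ← Finset.sum_add_distrib]
  exact Finset.sum_congr rfl fun k _ => (add_sub_cancel _ _).symm

variable {mΩ : MeasurableSpace Ω} {P : Measure Ω}

theorem memLp_fun_smul {E : Type*} [NormedAddCommGroup E] [NormedSpace ℝ E] (c : ℝ) {X : Ω → E}
    (hX : MemLp X 2 P) : MemLp (fun ω => c • X ω) 2 P :=
  hX.const_smul c

theorem memLp_fun_add {E : Type*} [NormedAddCommGroup E] {X Y : Ω → E}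
    (hX : MemLp X 2 P) (hY : MemLp Y 2 P) : MemLp (fun ω => X ω + Y ω) 2 P :=
  hX.add hY

theorem integral_roundTerm_le {E E' : Type*} [NormedAddCommGroup E] [InnerProductSpace ℝ E]
    [NormedAddCommGroup E'] [InnerProductSpace ℝ E'] {L γ α β : ℝ} {m : ℕ} {g : Ω → E}
    {q : Fin n → Ω → E'} {N : Fin n → Ω → E} {M : Fin n → Ω → E'} {A : Finset (Fin n)}
    (hL : 0 ≤ L) (hg : MemLp g 2 P) (hq : ∀ i, MemLp (q i) 2 P) (hN : ∀ i, MemLp (N i) 2 P)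
    (hM : ∀ i, MemLp (M i) 2 P) (hgN : ∀ i, ∫ ω, ⟪g ω, N i ω⟫ ∂P = 0)
    (hqM : ∀ i, ∫ ω, ⟪q i ω, M i ω⟫ ∂P = 0) (hα : ∫ ω, ‖∑ i ∈ A, N i ω‖ ^ 2 ∂P ≤ α)
    (hβ : ∀ i, ∫ ω, ‖M i ω‖ ^ 2 ∂P ≤ β) :
    ∫ ω, roundTerm L γ m (g ω) (fun i => q i ω) (fun i => N i ω) (fun i => M i ω) A ∂P
      ≤ 2 * L * γ ^ 2 / m ^ 2 * α + 1 / n * (A.card * (2 * L * γ ^ 2 * β)) := by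
  have i1 : Integrable (fun ω => -(γ / m) * ∑ i ∈ A, ⟪g ω, N i ω⟫) P :=
    (integrable_finsetSum _ fun i _ => integrable_inner_of_memLp_two hg (hN i)).const_mul _
  have i2 : Integrable (fun ω => 2 * L * γ ^ 2 / m ^ 2 * ‖∑ i ∈ A, N i ω‖ ^ 2) P :=
    ((memLp_finsetSum _ fun i _ => hN i).integrable_norm_pow two_ne_zero).const_mul _
  have i3 : ∀ i, Integrable (fun ω => -γ * ⟪q i ω, M i ω⟫) P := fun i =>
    (integrable_inner_of_memLp_two (hq i) (hM i)).const_mul _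
  have i4 : ∀ i, Integrable (fun ω => 2 * L * γ ^ 2 * ‖M i ω‖ ^ 2) P := fun i =>
    ((hM i).integrable_norm_pow two_ne_zero).const_mul _
  have i34 : ∀ i, Integrable (fun ω => -γ * ⟪q i ω, M i ω⟫ + 2 * L * γ ^ 2 * ‖M i ω‖ ^ 2) P :=
    fun i => (i3 i).add (i4 i)
  have i12 : Integrable (fun ω => -(γ / m) * ∑ i ∈ A, ⟪g ω, N i ω⟫
      + 2 * L * γ ^ 2 / m ^ 2 * ‖∑ i ∈ A, N i ω‖ ^ 2) P := i1.add i2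
  have i5 : Integrable (fun ω => 1 / (n : ℝ) * ∑ i ∈ A, (-γ * ⟪q i ω, M i ω⟫
      + 2 * L * γ ^ 2 * ‖M i ω‖ ^ 2)) P :=
    (integrable_finsetSum _ fun i _ => i34 i).const_mul _
  have z1 : ∫ ω, ∑ i ∈ A, ⟪g ω, N i ω⟫ ∂P = 0 := by
    rw [integral_finsetSum _ fun i _ => integrable_inner_of_memLp_two hg (hN i)]
    exact Finset.sum_eq_zero fun i _ => hgN i
  have z5 : ∫ ω, ∑ i ∈ A, (-γ * ⟪q i ω, M i ω⟫ + 2 * L * γ ^ 2 * ‖M i ω‖ ^ 2) ∂P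
      ≤ A.card * (2 * L * γ ^ 2 * β) := by
    rw [integral_finsetSum _ fun i _ => i34 i, ← nsmul_eq_mul, ← Finset.sum_const]
    refine Finset.sum_le_sum fun i _ => ?_
    rw [integral_add (i3 i) (i4 i), integral_const_mul, integral_const_mul, hqM, mul_zero,
      zero_add]
    exact mul_le_mul_of_nonneg_left (hβ i) (by positivity)
  simp only [roundTerm]
  rw [integral_add i12 i5, integral_add i1 i2, integral_const_mul, integral_const_mul,
    integral_const_mul, z1, mul_zero, zero_add]
  exact add_le_add (mul_le_mul_of_nonneg_left hα (by positivity))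
    (mul_le_mul_of_nonneg_left z5 (by positivity))

variable [MeasurableSpace Ξ] {F : Vec du → Vec dv → Ξ → ℝ} {D : Fin n → Measure Ξ}
  [IsProbabilityMeasure P] [∀ i, IsProbabilityMeasure (D i)]
  {L σu σv γu γv ηu ηv : ℝ} {x : Ω → Vec du × (Fin n → Vec dv)}
  {𝓜 : Fin n → ℕ → MeasurableSpace Ω} {m : ℕ}

theorem Adapted.memLp_noiseSum {d : ℕ} {g : Vec du → Vec dv → Ξ → Vec d}
    {G : Fin n → Vec du → Vec dv → Vec d} {σ : ℝ} {p : Fin n → ℕ → Ω → Vec du × Vec dv}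
    (h : Adapted P D ζ p 𝓜) (hg : ∀ i, Oracle g (G i) (D i) L σ) (i : Fin n) :
    MemLp (noiseSum g G p ζ K i) 2 P :=
  memLp_finsetSum _ fun k _ => h.memLp_noise hg i k

theorem Adapted.integral_inner_noiseSum {d : ℕ} {g : Vec du → Vec dv → Ξ → Vec d}
    {G : Fin n → Vec du → Vec dv → Vec d} {σ : ℝ} {p : Fin n → ℕ → Ω → Vec du × Vec dv}
    (h : Adapted P D ζ p 𝓜) (hg : ∀ i, Oracle g (G i) (D i) L σ) (i : Fin n) {Y : Ω → Vec d}
    (hY : ∀ k, Measurable[𝓜 i k] Y) (hY2 : MemLp Y 2 P) :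
    ∫ ω, ⟪Y ω, noiseSum g G p ζ K i ω⟫ ∂P = 0 := by
  simp only [noiseSum, inner_sum]
  rw [integral_finsetSum _ fun k _ => integrable_inner_of_memLp_two hY2 (h.memLp_noise hg i k)]
  exact Finset.sum_eq_zero fun k _ => h.integral_inner_noise hg i k (hY k) hY2

namespace RoundModel

theorem memLp_mean_gradU (h : RoundModel P F D L σu σv γu γv ζ x 𝓜) :
    MemLp (fun ω => (1 / (n : ℝ)) • ∑ i, gradU (clientObj F D i) (x ω).1 ((x ω).2 i)) 2 P :=
  memLp_fun_smul _ (memLp_finsetSum _ fun i _ => h.memLp_gradU_start i)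

/-- The `m K` errors of the shared block are orthogonal, so the factor `1 / m ^ 2` of the averaged
step leaves `1 / m`. A personal block sees only its own `K` errors, and `m` of the `n` blocks move.
-/
theorem integral_roundTerm_noise_le (h : RoundModel P F D L σu σv γu γv ζ x 𝓜) (hm : 1 ≤ m)
    (hn : 1 ≤ n) {A : Finset (Fin n)} (hA : A.card = m) (γ : ℝ) :
    ∫ ω, roundTerm L γ m ((1 / (n : ℝ)) • ∑ i, gradU (clientObj F D i) (x ω).1 ((x ω).2 i))
        (fun i => gradV (clientObj F D i) (x ω).1 ((x ω).2 i))
        (fun i => noiseSum (stochGradU F) (fun i => gradU (clientObj F D i))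
          (localPt F γu γv ζ x) ζ K i ω)
        (fun i => noiseSum (stochGradV F) (fun i => gradV (clientObj F D i))
          (localPt F γu γv ζ x) ζ K i ω) A ∂P
      ≤ 2 * L * γ ^ 2 * K * (σu ^ 2 / m + m * σv ^ 2 / n) := by
  have hm0 : (0 : ℝ) < m := by exact_mod_cast hm
  have hn0 : (0 : ℝ) < n := by exact_mod_cast hn
  -- Points with step index `0` are measurable for every `𝓜 i k`, hence so are the gradients at the
  -- start of the round; the linear noise terms therefore vanish.
  have hpt : ∀ i k j, Measurable[𝓜 i k] (localPt F γu γv ζ x j 0) := fun i k j =>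
    h.adapted.measurable_point i k j 0 fun _ => Nat.zero_le k
  have hgbm : ∀ i k, Measurable[𝓜 i k] fun ω =>
      (1 / (n : ℝ)) • ∑ i, gradU (clientObj F D i) (x ω).1 ((x ω).2 i) := fun i k =>
    (measurable_const_smul (1 / (n : ℝ))).comp (Finset.measurable_fun_sum _ fun j _ =>
      (h.smooth j).continuous_gradU.measurable.comp (hpt i k j))
  have hqm : ∀ i k, Measurable[𝓜 i k] fun ω =>
      gradV (clientObj F D i) (x ω).1 ((x ω).2 i) := fun i k =>
    (h.smooth i).continuous_gradV.measurable.comp (hpt i k i)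
  have z2 := h.adapted.integral_norm_sum_noise_sq_le h.oracle_u A K
  have z4 : ∀ i, ∫ ω, ‖noiseSum (stochGradV F) (fun i => gradV (clientObj F D i))
      (localPt F γu γv ζ x) ζ K i ω‖ ^ 2 ∂P ≤ K * σv ^ 2 := fun i => by
    have := h.adapted.integral_norm_sum_noise_sq_le h.oracle_v {i} K
    simpa only [noiseSum, Finset.sum_singleton, Finset.card_singleton, Nat.cast_one, one_mul]
      using this
  rw [hA] at z2
  refine (integral_roundTerm_le (h.smooth ⟨0, hn⟩).nonneg h.memLp_mean_gradU h.memLp_gradV_start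
    (h.adapted.memLp_noiseSum h.oracle_u) (h.adapted.memLp_noiseSum h.oracle_v)
    (fun i => h.adapted.integral_inner_noiseSum h.oracle_u i (hgbm i) h.memLp_mean_gradU)
    (fun i => h.adapted.integral_inner_noiseSum h.oracle_v i (hqm i) (h.memLp_gradV_start i))
    z2 z4).trans_eq ?_
  rw [hA]
  field_simp

theorem memLp_fedRound_fst (h : RoundModel P F D L σu σv γu γv ζ x 𝓜) (A : Finset (Fin n)) :
    MemLp (fun ω => (fedRound F γu γv ηu ηv m K A (fun i k => ζ i k ω) (x ω)).1) 2 P := by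
  simp only [fedRound]
  exact memLp_fun_add (memLp_fun_smul _ h.memLp_u)
    (memLp_fun_smul _ (memLp_finsetSum _ fun i _ => (h.memLp_localPt i K).1))

theorem memLp_fedRound_snd (h : RoundModel P F D L σu σv γu γv ζ x 𝓜) (A : Finset (Fin n))
    (i : Fin n) :
    MemLp (fun ω => (fedRound F γu γv ηu ηv m K A (fun i k => ζ i k ω) (x ω)).2 i) 2 P := by
  by_cases hi : i ∈ A
  · simp only [fedRound, hi, if_true]
    exact memLp_fun_add (memLp_fun_smul _ (h.memLp_v i))
      (memLp_fun_smul _ (h.memLp_localPt i K).2)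
  · simpa only [fedRound, hi, if_false] using h.memLp_v i

theorem integral_fedRound_le (h : RoundModel P F D L σu σv γu γv ζ x 𝓜) (hm : 1 ≤ m)
    (hn : 1 ≤ n) {A : Finset (Fin n)} (hA : A.card = m) {γ : ℝ} (hγu : γu * ηu = γ)
    (hγv : γv * ηv = γ) :
    ∫ ω, globalObj F D (fedRound F γu γv ηu ηv m K A (fun i k => ζ i k ω) (x ω)).1
        (fedRound F γu γv ηu ηv m K A (fun i k => ζ i k ω) (x ω)).2 ∂P
      ≤ ∫ ω, globalObj F D (x ω).1 (x ω).2 ∂P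
        + ∫ ω, roundTerm L γ m
          ((1 / (n : ℝ)) • ∑ i, gradU (clientObj F D i) (x ω).1 ((x ω).2 i))
          (fun i => gradV (clientObj F D i) (x ω).1 ((x ω).2 i))
          (fun i => fieldSum (fun i => gradU (clientObj F D i)) (localPt F γu γv ζ x) K i ω)
          (fun i => fieldSum (fun i => gradV (clientObj F D i)) (localPt F γu γv ζ x) K i ω) A ∂P
        + 2 * L * γ ^ 2 * K * (σu ^ 2 / m + m * σv ^ 2 / n) := by
  have hL := (h.smooth ⟨0, hn⟩).nonneg
  have iR := integrable_roundTerm (L := L) (m := m) (γ := γ) h.memLp_mean_gradU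
    h.memLp_gradV_start
    (a := fieldSum (fun i => gradU (clientObj F D i)) (localPt F γu γv ζ x) K)
    (c := fieldSum (fun i => gradV (clientObj F D i)) (localPt F γu γv ζ x) K)
    (fun i => memLp_finsetSum _ fun k _ => h.memLp_gradU i k)
    (fun i => memLp_finsetSum _ fun k _ => h.memLp_gradV i k) A
  have iZ := integrable_roundTerm (L := L) (m := m) (γ := γ) h.memLp_mean_gradU
    h.memLp_gradV_start
    (h.adapted.memLp_noiseSum (K := K) h.oracle_u)
    (h.adapted.memLp_noiseSum (K := K) h.oracle_v) A
  have iF := integrable_globalObj h.smooth h.memLp_u h.memLp_v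
  have iN := integrable_globalObj h.smooth
    (y := fun ω => fedRound F γu γv ηu ηv m K A (fun i k => ζ i k ω) (x ω))
    (h.memLp_fedRound_fst A) (h.memLp_fedRound_snd A)
  refine (integral_mono iN ((iF.add iR).add iZ) fun ω => ?_).trans ?_
  · have h1 := globalObj_le h.smooth hn (x ω).1
      (fedRound F γu γv ηu ηv m K A (fun i k => ζ i k ω) (x ω)).1 (x ω).2
      (fedRound F γu γv ηu ηv m K A (fun i k => ζ i k ω) (x ω)).2
    simp only [fedRound_fst hm hA, fedRound_snd, hγu, hγv,
      sum_oracle_eq (stochGradU F) (fun i => gradU (clientObj F D i)),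
      sum_oracle_eq (stochGradV F) (fun i => gradV (clientObj F D i))] at h1
    have h2 := inner_add_norm_sq_le_roundTerm (m := m) (γ := γ) hL
      ((1 / (n : ℝ)) • ∑ i, gradU (clientObj F D i) (x ω).1 ((x ω).2 i))
      (fun i => gradV (clientObj F D i) (x ω).1 ((x ω).2 i))
      (fun i => fieldSum (fun i => gradU (clientObj F D i)) (localPt F γu γv ζ x) K i ω)
      (fun i => noiseSum (stochGradU F) (fun i => gradU (clientObj F D i))
          (localPt F γu γv ζ x) ζ K i ω)
      (fun i => fieldSum (fun i => gradV (clientObj F D i)) (localPt F γu γv ζ x) K i ω)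
      (fun i => noiseSum (stochGradV F) (fun i => gradV (clientObj F D i))
          (localPt F γu γv ζ x) ζ K i ω) A
    simp only [Pi.add_apply]
    linarith
  · simp only [Pi.add_apply]
    have h3 := h.integral_roundTerm_noise_le (K := K) hm hn hA γ
    have h4 := integral_add (iF.add iR) iZ
    have h5 := integral_add iF iR
    simp only [Pi.add_apply] at h4 h5
    rw [h4, h5]
    linarith

end RoundModel

end OneRound

end FedAvgP

namespace FedAvgP

open scoped RealInnerProductSpace

/-! ### Measurability of a round with a random client set -/

section Measurability

variable {du dv n : ℕ} {Ξ Ω : Type*} [MeasurableSpace Ξ] [MeasurableSpace Ω]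
  {F : Vec du → Vec dv → Ξ → ℝ} {γu γv ηu ηv : ℝ} {m K : ℕ}

theorem measurable_fedRound
    (hFu : Measurable fun p : (Vec du × Vec dv) × Ξ => stochGradU F p.1.1 p.1.2 p.2)
    (hFv : Measurable fun p : (Vec du × Vec dv) × Ξ => stochGradV F p.1.1 p.1.2 p.2)
    {S : Ω → Finset (Fin n)} (hS : Measurable S) {ζ : Fin n → ℕ → Ω → Ξ}
    (hζ : ∀ i k, Measurable (ζ i k)) {x : Ω → Vec du × (Fin n → Vec dv)} (hx : Measurable x) :
    Measurable fun ω => fedRound F γu γv ηu ηv m K (S ω) (fun i k => ζ i k ω) (x ω) := by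
  have hp : ∀ i, Measurable (localPt F γu γv ζ x i K) := fun i =>
    measurable_localPt hFu hFv hx i K fun l _ => hζ i l
  have hmem : ∀ i, MeasurableSet {ω | i ∈ S ω} := fun i => hS (measurableSet_mem_finset i)
  refine Measurable.prodMk ?_ (measurable_pi_lambda _ fun i => ?_)
  -- A sum over a random set becomes a sum over all clients with measurable indicators.
  · have e : (fun ω => ∑ i ∈ S ω,
        (localIter F γu γv ((fun i k => ζ i k ω) i) (x ω).1 ((x ω).2 i) K).1)
        = fun ω => ∑ i, if i ∈ S ω then (localPt F γu γv ζ x i K ω).1 else 0 := by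
      funext ω
      rw [Finset.sum_ite_mem, Finset.univ_inter]
      rfl
    have hsum : Measurable fun ω => ∑ i ∈ S ω,
        (localIter F γu γv ((fun i k => ζ i k ω) i) (x ω).1 ((x ω).2 i) K).1 := by
      rw [e]
      exact Finset.measurable_fun_sum _ fun i _ => Measurable.ite (hmem i) (hp i).fst
        measurable_const
    exact ((measurable_const_smul (1 - ηu)).comp hx.fst).add
      ((measurable_const_smul (ηu / (m : ℝ))).comp hsum)
  · have hxi : Measurable fun ω => (x ω).2 i := (measurable_pi_apply i).comp hx.snd
    exact Measurable.ite (hmem i) (((measurable_const_smul (1 - ηv)).comp hxi).add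
      ((measurable_const_smul ηv).comp (hp i).snd)) hxi

end Measurability

/-! ### Averaging a round over the client draw -/

section Averaging

variable {du dv n : ℕ} {Ξ Ω : Type*} [MeasurableSpace Ξ] {F : Vec du → Vec dv → Ξ → ℝ}
  {D : Fin n → Measure Ξ} {L σu σv γu γv ηu ηv : ℝ} {m K : ℕ}

theorem Oracle.norm_fieldSum_sub_sq_le {d : ℕ} {g : Vec du → Vec dv → Ξ → Vec d}
    {G : Fin n → Vec du → Vec dv → Vec d} {σ : ℝ} (hg : ∀ i, Oracle g (G i) (D i) L σ)
    (ζ : Fin n → ℕ → Ω → Ξ) (x : Ω → Vec du × (Fin n → Vec dv)) (i : Fin n) (ω : Ω) :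
    ‖fieldSum G (localPt F γu γv ζ x) K i ω - (K : ℝ) • G i (x ω).1 ((x ω).2 i)‖ ^ 2
      ≤ 2 * K * L ^ 2 * ∑ k ∈ Finset.range K, localDist F γu γv ζ x i k ω := by
  have e : fieldSum G (localPt F γu γv ζ x) K i ω - (K : ℝ) • G i (x ω).1 ((x ω).2 i)
      = ∑ k ∈ Finset.range K, (G i (localPt F γu γv ζ x i k ω).1 (localPt F γu γv ζ x i k ω).2
        - G i (x ω).1 ((x ω).2 i)) := by
    rw [fieldSum, Finset.sum_sub_distrib, Finset.sum_const, Finset.card_range,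
      Nat.cast_smul_eq_nsmul]
  rw [e]
  refine (pow_le_pow_left₀ (norm_nonneg _) (norm_sum_le _ _) 2).trans ?_
  refine sq_sum_le_card_mul_sum_sq.trans ?_
  rw [Finset.card_range]
  refine (mul_le_mul_of_nonneg_left (Finset.sum_le_sum fun k _ =>
    (hg i).norm_sub_sq_le i k ω) K.cast_nonneg).trans_eq ?_
  rw [← Finset.mul_sum]
  ring

variable {𝓢 mΩ : MeasurableSpace Ω} {P : Measure Ω}

theorem subsetAvg_integral {φ : Finset (Fin n) → Ω → ℝ} (hφ : ∀ A, Integrable (φ A) P) :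
    subsetAvg n m (fun A => ∫ ω, φ A ω ∂P) = ∫ ω, subsetAvg n m (fun A => φ A ω) ∂P := by
  simp only [subsetAvg]
  rw [integral_const_mul, integral_finsetSum _ fun A _ => hφ A]

variable [IsProbabilityMeasure P] [∀ i, IsProbabilityMeasure (D i)] {ζ : Fin n → ℕ → Ω → Ξ}
  {x : Ω → Vec du × (Fin n → Vec dv)} {𝓜 : Fin n → ℕ → MeasurableSpace Ω}

namespace RoundModel

theorem integral_subsetAvg_roundTerm_le (h : RoundModel P F D L σu σv γu γv ζ x 𝓜) (hm : 1 ≤ m)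
    (hmn : m ≤ n) (hK : 1 ≤ K) {γ b : ℝ} (hγ : 0 < γ) (hγL : 32 * L * K * γ ≤ 1)
    (hb : ∀ (u : Vec du) (v : Fin n → Vec dv),
      1 / (n : ℝ) * ∑ i, ‖gradU (clientObj F D i) u (v i)‖ ^ 2
        ≤ b ^ 2 + ‖(1 / (n : ℝ)) • ∑ i, gradU (clientObj F D i) u (v i)‖ ^ 2) :
    subsetAvg n m (fun A => ∫ ω, roundTerm L γ m
          ((1 / (n : ℝ)) • ∑ i, gradU (clientObj F D i) (x ω).1 ((x ω).2 i))
          (fun i => gradV (clientObj F D i) (x ω).1 ((x ω).2 i))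
          (fun i => fieldSum (fun i => gradU (clientObj F D i)) (localPt F γu γv ζ x) K i ω)
          (fun i => fieldSum (fun i => gradV (clientObj F D i)) (localPt F γu γv ζ x) K i ω) A ∂P)
      ≤ -(γ * K / 2)
          * (∫ ω, ‖(1 / (n : ℝ)) • ∑ i, gradU (clientObj F D i) (x ω).1 ((x ω).2 i)‖ ^ 2 ∂P
            + m / n ^ 2 * ∑ i, ∫ ω, ‖gradV (clientObj F D i) (x ω).1 ((x ω).2 i)‖ ^ 2 ∂P)
        + 8 * (n - m) / (m * n) * L * K ^ 2 * γ ^ 2 * b ^ 2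
        + 5 / 2 * γ * L ^ 2 * (1 / (n : ℝ) * ∑ i, ∑ k ∈ Finset.range K,
          ∫ ω, localDist F γu γv ζ x i k ω ∂P) := by
  have hL := (h.smooth ⟨0, hm.trans hmn⟩).nonneg
  have iR := fun A => integrable_roundTerm (L := L) (m := m) (γ := γ) h.memLp_mean_gradU
    h.memLp_gradV_start
    (a := fieldSum (fun i => gradU (clientObj F D i)) (localPt F γu γv ζ x) K)
    (c := fieldSum (fun i => gradV (clientObj F D i)) (localPt F γu γv ζ x) K)
    (fun i => memLp_finsetSum _ fun k _ => h.memLp_gradU i k)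
    (fun i => memLp_finsetSum _ fun k _ => h.memLp_gradV i k) A
  have iU := h.memLp_mean_gradU.integrable_norm_pow two_ne_zero
  have iV : Integrable (fun ω => m / n ^ 2 * ∑ i,
      ‖gradV (clientObj F D i) (x ω).1 ((x ω).2 i)‖ ^ 2) P :=
    (integrable_finsetSum _ fun i _ =>
      (h.memLp_gradV_start i).integrable_norm_pow two_ne_zero).const_mul _
  have iW : Integrable (fun ω => 1 / (n : ℝ) * ∑ i, ∑ k ∈ Finset.range K,
      localDist F γu γv ζ x i k ω) P :=
    (integrable_finsetSum _ fun i _ => integrable_finsetSum _ fun k _ =>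
      h.integrable_localDist i k).const_mul _
  have iUV : Integrable (fun ω =>
      ‖(1 / (n : ℝ)) • ∑ i, gradU (clientObj F D i) (x ω).1 ((x ω).2 i)‖ ^ 2
        + m / n ^ 2 * ∑ i, ‖gradV (clientObj F D i) (x ω).1 ((x ω).2 i)‖ ^ 2) P := iU.add iV
  have iUVb : Integrable (fun ω => -(γ * K / 2) *
      (‖(1 / (n : ℝ)) • ∑ i, gradU (clientObj F D i) (x ω).1 ((x ω).2 i)‖ ^ 2
        + m / n ^ 2 * ∑ i, ‖gradV (clientObj F D i) (x ω).1 ((x ω).2 i)‖ ^ 2)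
      + 8 * (n - m) / (m * n) * L * K ^ 2 * γ ^ 2 * b ^ 2) P :=
    (iUV.const_mul _).add (integrable_const _)
  rw [subsetAvg_integral iR]
  have hint : Integrable (fun ω => subsetAvg n m fun A => roundTerm L γ m
      ((1 / (n : ℝ)) • ∑ i, gradU (clientObj F D i) (x ω).1 ((x ω).2 i))
      (fun i => gradV (clientObj F D i) (x ω).1 ((x ω).2 i))
      (fun i => fieldSum (fun i => gradU (clientObj F D i)) (localPt F γu γv ζ x) K i ω)
      (fun i => fieldSum (fun i => gradV (clientObj F D i)) (localPt F γu γv ζ x) K i ω) A) P :=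
    (integrable_finsetSum _ fun A _ => iR A).const_mul _
  -- The deterministic estimate is applied for each `ω` separately, with `W i` the realized drift of
  -- client `i`.
  refine (integral_mono hint (iUVb.add (iW.const_mul (5 / 2 * γ * L ^ 2))) fun ω =>
    subsetAvg_round_le hm hmn hγ (by exact_mod_cast hK) hL hγL
      (W := fun i => ∑ k ∈ Finset.range K, localDist F γu γv ζ x i k ω)
      (fun i => Finset.sum_nonneg fun k _ => localDist_nonneg i k ω)
      (fun i => Oracle.norm_fieldSum_sub_sq_le h.oracle_u ζ x i ω)
      (fun i => Oracle.norm_fieldSum_sub_sq_le h.oracle_v ζ x i ω)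
      (hb (x ω).1 (x ω).2) rfl).trans_eq ?_
  simp only [Pi.add_apply]
  rw [integral_add iUVb (iW.const_mul _), integral_add (iUV.const_mul _) (integrable_const _),
    integral_const_mul, integral_add iU iV, integral_const_mul, integral_const_mul,
    integral_const_mul, integral_const_mul, integral_const,
    integral_finsetSum _ fun i _ => (h.memLp_gradV_start i).integrable_norm_pow two_ne_zero,
    integral_finsetSum _ fun i _ => integrable_finsetSum _ fun k _ => h.integrable_localDist i k]
  simp only [integral_finsetSum _ fun k _ => h.integrable_localDist _ k]
  simp

variable {S : Ω → Finset (Fin n)}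

/-- Each outcome with a fixed client set is square integrable, and the draw only averages finitely
many of them. This carries the second moments from one round to the next. -/
theorem memLp_next (h : RoundModel P F D L σu σv γu γv ζ x 𝓜) (hn : 1 ≤ n) (hmn : m ≤ n)
    (hS : Measurable S) (hle : 𝓢 ≤ mΩ)
    (hind : Indep 𝓢 (MeasurableSpace.comap S inferInstance) P)
    (hunif : ∀ A : Finset (Fin n), A.card = m →
      P {ω | S ω = A} = ((n.choose m : ℕ) : ENNReal)⁻¹)
    (hx : Measurable[𝓢] x) (hζ : ∀ i k, Measurable[𝓢] (ζ i k)) :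
    MemLp (fun ω => (fedRound F γu γv ηu ηv m K (S ω) (fun i k => ζ i k ω) (x ω)).1) 2 P ∧
      ∀ i, MemLp (fun ω => (fedRound F γu γv ηu ηv m K (S ω) (fun i k => ζ i k ω) (x ω)).2 i)
        2 P := by
  have hmeas := measurable_fedRound (γu := γu) (γv := γv) (ηu := ηu) (ηv := ηv) (m := m) (K := K)
    (h.oracle_u ⟨0, hn⟩).measurable (h.oracle_v ⟨0, hn⟩).measurable hS
    (fun i k => (hζ i k).mono hle le_rfl) (hx.mono hle le_rfl)
  have hmeasA := fun A : Finset (Fin n) => @measurable_fedRound du dv n Ξ Ω _ 𝓢 F γu γv ηu ηv m K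
    (h.oracle_u ⟨0, hn⟩).measurable (h.oracle_v ⟨0, hn⟩).measurable (fun _ => A)
    (@measurable_const _ _ _ 𝓢 A) ζ hζ x hx
  refine ⟨(memLp_two_iff_integrable_sq_norm hmeas.fst.aestronglyMeasurable).2
    (integral_comp_subset hmn hS hle hind hunif (fun A =>
      (continuous_norm.pow 2).measurable.comp (hmeasA A).fst)
      fun A => (h.memLp_fedRound_fst A).integrable_norm_pow two_ne_zero).1, fun i => ?_⟩
  have hi : Measurable fun ω =>
      (fedRound F γu γv ηu ηv m K (S ω) (fun i k => ζ i k ω) (x ω)).2 i :=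
    (measurable_pi_apply i).comp hmeas.snd
  have hiA : ∀ A : Finset (Fin n), Measurable[𝓢] fun ω =>
      (fedRound F γu γv ηu ηv m K A (fun i k => ζ i k ω) (x ω)).2 i := fun A =>
    (measurable_pi_apply i).comp (hmeasA A).snd
  exact (memLp_two_iff_integrable_sq_norm hi.aestronglyMeasurable).2
    (integral_comp_subset hmn hS hle hind hunif (fun A =>
      (continuous_norm.pow 2).measurable.comp (hiA A))
      fun A => (h.memLp_fedRound_snd A i).integrable_norm_pow two_ne_zero).1

theorem integral_next_le (h : RoundModel P F D L σu σv γu γv ζ x 𝓜) (hm : 1 ≤ m) (hmn : m ≤ n)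
    (hK : 1 ≤ K) {γ b : ℝ} (hγ : 0 < γ) (hγL : 32 * L * K * γ ≤ 1)
    (hγu : γu * ηu = γ) (hγv : γv * ηv = γ)
    (hb : ∀ (u : Vec du) (v : Fin n → Vec dv),
      1 / (n : ℝ) * ∑ i, ‖gradU (clientObj F D i) u (v i)‖ ^ 2
        ≤ b ^ 2 + ‖(1 / (n : ℝ)) • ∑ i, gradU (clientObj F D i) u (v i)‖ ^ 2)
    (hS : Measurable S) (hle : 𝓢 ≤ mΩ)
    (hind : Indep 𝓢 (MeasurableSpace.comap S inferInstance) P)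
    (hunif : ∀ A : Finset (Fin n), A.card = m →
      P {ω | S ω = A} = ((n.choose m : ℕ) : ENNReal)⁻¹)
    (hx : Measurable[𝓢] x) (hζ : ∀ i k, Measurable[𝓢] (ζ i k)) :
    ∫ ω, globalObj F D (fedRound F γu γv ηu ηv m K (S ω) (fun i k => ζ i k ω) (x ω)).1
        (fedRound F γu γv ηu ηv m K (S ω) (fun i k => ζ i k ω) (x ω)).2 ∂P
      ≤ ∫ ω, globalObj F D (x ω).1 (x ω).2 ∂P
        - γ * K / 2
          * (∫ ω, ‖(1 / (n : ℝ)) • ∑ i, gradU (clientObj F D i) (x ω).1 ((x ω).2 i)‖ ^ 2 ∂P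
            + m / n ^ 2 * ∑ i, ∫ ω, ‖gradV (clientObj F D i) (x ω).1 ((x ω).2 i)‖ ^ 2 ∂P)
        + 8 * (n - m) / (m * n) * L * K ^ 2 * γ ^ 2 * b ^ 2
        + 5 / 2 * γ * L ^ 2 * (1 / (n : ℝ) * ∑ i, ∑ k ∈ Finset.range K,
          ∫ ω, localDist F γu γv ζ x i k ω ∂P)
        + 2 * L * γ ^ 2 * K * (σu ^ 2 / m + m * σv ^ 2 / n) := by
  have hn := hm.trans hmn
  have hmeasA := fun A : Finset (Fin n) => @measurable_fedRound du dv n Ξ Ω _ 𝓢 F γu γv ηu ηv m K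
    (h.oracle_u ⟨0, hn⟩).measurable (h.oracle_v ⟨0, hn⟩).measurable (fun _ => A)
    (@measurable_const _ _ _ 𝓢 A) ζ hζ x hx
  rw [(integral_comp_subset hmn hS hle hind hunif
    (Φ := fun A ω => globalObj F D (fedRound F γu γv ηu ηv m K A (fun i k => ζ i k ω) (x ω)).1
      (fedRound F γu γv ηu ηv m K A (fun i k => ζ i k ω) (x ω)).2)
    (fun A => (continuous_globalObj h.smooth).measurable.comp (hmeasA A))
    (fun A => integrable_globalObj h.smooth (h.memLp_fedRound_fst A)
      (h.memLp_fedRound_snd A))).2]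
  refine (subsetAvg_mono fun A hA => h.integral_fedRound_le hm hn hA hγu hγv).trans ?_
  rw [subsetAvg_add, subsetAvg_add, subsetAvg_const hmn, subsetAvg_const hmn]
  have := h.integral_subsetAvg_roundTerm_le hm hmn hK hγ hγL hb
  linarith

end RoundModel

end Averaging

end FedAvgP

namespace FedAvgP

open scoped RealInnerProductSpace

/-! ### Expected descent in one round -/

section Descent

/-- Inserting the drift bound produces multiples of the descent quantity, of the variance terms and
of `b ^ 2`. Smallness of `L κ γ` lets the first be paid by half of the descent and the second join
the variance already present. -/
theorem round_scalar_le {γ κ L m n b A Gu Gv w su sv γu2 γv2 : ℝ} (hm : 1 ≤ m) (hmn : m ≤ n)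
    (hγ : 0 < γ) (hκ : 1 ≤ κ) (hL : 0 ≤ L) (hγL : 32 * L * κ * γ ≤ 1) (hγu0 : 0 ≤ γu2)
    (hγu : γu2 ≤ γ ^ 2 / m) (hγv : γv2 ≤ γ ^ 2 * (m / n)) (hGu : 0 ≤ Gu) (hGv : 0 ≤ Gv)
    (hA : A ≤ b ^ 2 + Gu)
    (hw : w ≤ 3 * κ ^ 2 * (κ - 1) * (γu2 * A + γv2 * (1 / n * Gv))
      + 2 * κ * (κ - 1) * (γu2 * su ^ 2 + γv2 * sv ^ 2)) :
    -(γ * κ / 2 * (Gu + m / n ^ 2 * Gv)) + 8 * (n - m) / (m * n) * L * κ ^ 2 * γ ^ 2 * b ^ 2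
        + 5 / 2 * γ * L ^ 2 * w + 2 * L * γ ^ 2 * κ * (su ^ 2 / m + m * sv ^ 2 / n)
      ≤ -(γ * κ / 4 * (Gu + m / n ^ 2 * Gv))
        + γ * κ / 4 * (12 * L * (4 * (n - m) * κ * b ^ 2 / (m * n) + su ^ 2 / m + m * sv ^ 2 / n)
          * γ + 128 * L ^ 2 * κ * (κ - 1) * b ^ 2 * γu2) := by
  have hm0 : 0 < m := by linarith
  have hn0 : 0 < n := by linarith
  have hκ0 : 0 < κ := by linarith
  have hκ1 : 0 ≤ κ - 1 := by linarith
  set s := su ^ 2 / m + m * sv ^ 2 / n with hs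
  set H := Gu + m / n ^ 2 * Gv with hH
  set r := (n - m) / (m * n) with hr
  have hs0 : 0 ≤ s := by positivity
  have hH0 : 0 ≤ H := by positivity
  have hr0 : 0 ≤ r := div_nonneg (by linarith) (by positivity)
  have hγu' : γu2 ≤ γ ^ 2 := hγu.trans (div_le_self (by positivity) hm)
  -- The bound `γv2 ≤ γ ^ 2 (m / n)` turns the weight `1 / n` of the personal gradients into the
  -- weight `m / n ^ 2` of the descent. The factor `γu2` is kept in front of `b ^ 2`, where it
  -- yields the `1 / ηu ^ 2` of the final bound.
  have h1 : γu2 * A + γv2 * (1 / n * Gv) ≤ γu2 * b ^ 2 + γ ^ 2 * H := by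
    have e1 := mul_le_mul_of_nonneg_left hA hγu0
    have e2 := mul_le_mul_of_nonneg_right hγu' hGu
    have e3 := mul_le_mul_of_nonneg_right hγv (show 0 ≤ 1 / n * Gv by positivity)
    have e4 : γ ^ 2 * (m / n) * (1 / n * Gv) = γ ^ 2 * (m / n ^ 2 * Gv) := by field_simp
    rw [hH]
    linarith
  have h2 : γu2 * su ^ 2 + γv2 * sv ^ 2 ≤ γ ^ 2 * s := by
    have e1 := mul_le_mul_of_nonneg_right hγu (sq_nonneg su)
    have e2 := mul_le_mul_of_nonneg_right hγv (sq_nonneg sv)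
    have e3 : γ ^ 2 * s = γ ^ 2 / m * su ^ 2 + γ ^ 2 * (m / n) * sv ^ 2 := by
      rw [hs]; ring
    linarith
  have h3 : w ≤ 3 * κ ^ 2 * (κ - 1) * (γu2 * b ^ 2 + γ ^ 2 * H)
      + 2 * κ * (κ - 1) * (γ ^ 2 * s) :=
    hw.trans (add_le_add (mul_le_mul_of_nonneg_left h1 (by positivity))
      (mul_le_mul_of_nonneg_left h2 (by positivity)))
  have h4 := mul_le_mul_of_nonneg_left h3 (show 0 ≤ 5 / 2 * γ * L ^ 2 by positivity)
  -- The factor `(15 / 2) / 1024` is below `1 / 4`, so this part of the drift uses at most half of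
  -- the descent `γ κ / 2`.
  have h5 : 15 / 2 * γ * L ^ 2 * κ ^ 2 * (κ - 1) * γ ^ 2 * H ≤ γ * κ / 4 * H := by
    refine mul_le_mul_of_nonneg_right ?_ hH0
    have e1 : (L * κ * γ) ^ 2 ≤ (1 / 32) ^ 2 :=
      pow_le_pow_left₀ (by positivity) (by linarith) 2
    have e2 : 15 / 2 * γ * L ^ 2 * κ ^ 2 * (κ - 1) * γ ^ 2
        ≤ 15 / 2 * (γ * κ) * (L * κ * γ) ^ 2 := by
      have : 0 ≤ γ * L ^ 2 * κ ^ 2 * γ ^ 2 := by positivity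
      linarith
    have e3 := mul_le_mul_of_nonneg_left e1 (show 0 ≤ 15 / 2 * (γ * κ) by positivity)
    have e4 : 0 < γ * κ := by positivity
    linarith
  -- Together with the direct noise `2 L γ ^ 2 κ s` this makes `3 L γ ^ 2 κ s`, that is, `γ κ / 4`
  -- times `12 L γ s`.
  have h6 : 5 * γ * L ^ 2 * κ * (κ - 1) * γ ^ 2 * s ≤ L * γ ^ 2 * κ * s := by
    refine mul_le_mul_of_nonneg_right ?_ hs0
    have e1 : 0 ≤ L * γ ^ 2 * κ := by positivity
    have e2 : 5 * (L * κ * γ) ≤ 1 := by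
      have : 0 ≤ L * κ * γ := by positivity
      linarith
    have e3 := mul_le_mul_of_nonneg_left e2 e1
    have e4 : 0 ≤ 5 * γ * L ^ 2 * κ * γ ^ 2 := by positivity
    linarith
  -- Slack of the two `b ^ 2` terms: `15 / 2 ≤ 128 / 4` for the drift and `8 ≤ 48 / 4` for the
  -- sampling variance.
  have h7 : 0 ≤ γ * L ^ 2 * κ ^ 2 * (κ - 1) * γu2 * b ^ 2 := by positivity
  have h8 : 0 ≤ r * L * κ ^ 2 * γ ^ 2 * b ^ 2 := by positivity
  have e1 : 8 * (n - m) / (m * n) = 8 * r := by rw [hr]; ring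
  have e2 : 4 * (n - m) * κ * b ^ 2 / (m * n) + su ^ 2 / m + m * sv ^ 2 / n
      = 4 * r * κ * b ^ 2 + s := by rw [hr, hs]; ring
  rw [e1, e2]
  linarith

variable {du dv n : ℕ} {Ξ Ω : Type*} [MeasurableSpace Ξ] {F : Vec du → Vec dv → Ξ → ℝ}
  {D : Fin n → Measure Ξ} {L σu σv γu γv ηu ηv : ℝ} {m K : ℕ}
  {𝓢 mΩ : MeasurableSpace Ω} {P : Measure Ω} [IsProbabilityMeasure P]
  [∀ i, IsProbabilityMeasure (D i)] {ζ : Fin n → ℕ → Ω → Ξ}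
  {x : Ω → Vec du × (Fin n → Vec dv)} {𝓜 : Fin n → ℕ → MeasurableSpace Ω}
  {S : Ω → Finset (Fin n)}

/-- Expected decrease of the global objective in one round. -/
theorem RoundModel.descent (h : RoundModel P F D L σu σv γu γv ζ x 𝓜) (hm : 1 ≤ m) (hmn : m ≤ n)
    (hK : 1 ≤ K) {γ b : ℝ} (hγ : 0 < γ) (hγL : 32 * L * K * γ ≤ 1)
    (hγu : γu * ηu = γ) (hγv : γv * ηv = γ) (hηu : Real.sqrt m ≤ ηu)
    (hηv : Real.sqrt ((n : ℝ) / m) ≤ ηv) (hb : BoundedDissimilarity F D b)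
    (hS : Measurable S) (hle : 𝓢 ≤ mΩ)
    (hind : Indep 𝓢 (MeasurableSpace.comap S inferInstance) P)
    (hunif : ∀ A : Finset (Fin n), A.card = m →
      P {ω | S ω = A} = ((n.choose m : ℕ) : ENNReal)⁻¹)
    (hx : Measurable[𝓢] x) (hζ : ∀ i k, Measurable[𝓢] (ζ i k)) :
    ∫ ω, globalObj F D (fedRound F γu γv ηu ηv m K (S ω) (fun i k => ζ i k ω) (x ω)).1
        (fedRound F γu γv ηu ηv m K (S ω) (fun i k => ζ i k ω) (x ω)).2 ∂P
      ≤ ∫ ω, globalObj F D (x ω).1 (x ω).2 ∂P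
        - γ * K / 4 * (expGradU F D P x + expGradV F D P m x)
        + γ * K / 4 * (12 * L * (4 * ((n : ℝ) - m) * K * b ^ 2 / (m * n) + σu ^ 2 / m
          + m * σv ^ 2 / n) * γ + 128 * L ^ 2 * K * ((K : ℝ) - 1) * b ^ 2 / ηu ^ 2 * γ ^ 2) := by
  have hn := hm.trans hmn
  have hm1 : (1 : ℝ) ≤ m := by exact_mod_cast hm
  have hmn1 : (m : ℝ) ≤ n := by exact_mod_cast hmn
  have hK1 : (1 : ℝ) ≤ K := by exact_mod_cast hK
  have hn1 : (1 : ℝ) ≤ n := hm1.trans hmn1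
  have hL := (h.smooth ⟨0, hn⟩).nonneg
  have hgrad : ∀ (u : Vec du) (v : Fin n → Vec dv), globalGradU F D u v
      = (1 / (n : ℝ)) • ∑ i, gradU (clientObj F D i) u (v i) :=
    globalGradU_eq fun i => (h.smooth i).differentiable_u
  have hb' : ∀ (u : Vec du) (v : Fin n → Vec dv),
      1 / (n : ℝ) * ∑ i, ‖gradU (clientObj F D i) u (v i)‖ ^ 2
        ≤ b ^ 2 + ‖(1 / (n : ℝ)) • ∑ i, gradU (clientObj F D i) u (v i)‖ ^ 2 := by
    intro u v
    rw [← hgrad]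
    exact hb u v
  have hηu0 : 0 < ηu := (Real.sqrt_pos.2 (by linarith)).trans_le hηu
  have hηv0 : 0 < ηv := (Real.sqrt_pos.2 (by positivity)).trans_le hηv
  have hγu2 : γu ^ 2 = γ ^ 2 / ηu ^ 2 := by rw [← hγu]; field_simp
  have hγv2 : γv ^ 2 = γ ^ 2 / ηv ^ 2 := by rw [← hγv]; field_simp
  -- The conditions on `ηu` and `ηv` enter here, as bounds on the squared local step sizes.
  have hηu2 : (m : ℝ) ≤ ηu ^ 2 := (Real.sqrt_le_left hηu0.le).1 hηu
  have hηv2 : (n : ℝ) / m ≤ ηv ^ 2 := (Real.sqrt_le_left hηv0.le).1 hηv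
  have hγum : γu ^ 2 ≤ γ ^ 2 / m := by
    rw [hγu2]
    exact div_le_div_of_nonneg_left (sq_nonneg γ) (by linarith) hηu2
  have hγvm : γv ^ 2 ≤ γ ^ 2 * (m / n) := by
    rw [hγv2]
    refine (div_le_div_of_nonneg_left (sq_nonneg γ) (by positivity) hηv2).trans_eq ?_
    field_simp
  have hγu1 : γu ^ 2 ≤ γ ^ 2 := hγum.trans (div_le_self (by positivity) hm1)
  have hγv1 : γv ^ 2 ≤ γ ^ 2 :=
    hγvm.trans (mul_le_of_le_one_right (sq_nonneg γ) ((div_le_one (by linarith)).2 hmn1))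
  have hnext := h.integral_next_le hm hmn hK hγ hγL hγu hγv hb' hS hle hind hunif hx hζ
  set Gu := ∫ ω, ‖(1 / (n : ℝ)) • ∑ i, gradU (clientObj F D i) (x ω).1 ((x ω).2 i)‖ ^ 2 ∂P
    with hGu
  have hexpU : expGradU F D P x = Gu := by simp only [expGradU, hgrad, hGu]
  set gu : Fin n → ℝ := fun i => ∫ ω, ‖gradU (clientObj F D i) (x ω).1 ((x ω).2 i)‖ ^ 2 ∂P
  set gv : Fin n → ℝ := fun i => ∫ ω, ‖gradV (clientObj F D i) (x ω).1 ((x ω).2 i)‖ ^ 2 ∂P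
    with hgv
  have hexpV : expGradV F D P m x = m / n ^ 2 * ∑ i, gv i := rfl
  have hA : 1 / (n : ℝ) * ∑ i, gu i ≤ b ^ 2 + Gu := by
    have i1 : ∀ i, Integrable (fun ω => ‖gradU (clientObj F D i) (x ω).1 ((x ω).2 i)‖ ^ 2) P :=
      fun i => (h.memLp_gradU_start i).integrable_norm_pow two_ne_zero
    have i2 := h.memLp_mean_gradU.integrable_norm_pow two_ne_zero
    have e := integral_mono ((integrable_finsetSum _ fun i _ => i1 i).const_mul (1 / (n : ℝ)))
      ((integrable_const (b ^ 2)).add i2) fun ω => hb' (x ω).1 (x ω).2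
    have e2 := integral_add (integrable_const (μ := P) (b ^ 2)) i2
    simp only [Pi.add_apply] at e e2
    rw [integral_const_mul, integral_finsetSum _ fun i _ => i1 i, e2, integral_const,
      probReal_univ, one_smul] at e
    exact e
  have hw : 1 / (n : ℝ) * ∑ i, ∑ k ∈ Finset.range K, ∫ ω, localDist F γu γv ζ x i k ω ∂P
      ≤ 3 * (K : ℝ) ^ 2 * (K - 1) * (γu ^ 2 * (1 / (n : ℝ) * ∑ i, gu i)
          + γv ^ 2 * (1 / (n : ℝ) * ∑ i, gv i))
        + 2 * K * (K - 1) * (γu ^ 2 * σu ^ 2 + γv ^ 2 * σv ^ 2) := by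
    refine (mul_le_mul_of_nonneg_left (Finset.sum_le_sum fun i _ =>
      h.sum_integral_localDist_le hK hγL hγu1 hγv1 hγ i) (by positivity)).trans_eq ?_
    rw [Finset.sum_add_distrib, ← Finset.mul_sum, Finset.sum_add_distrib, ← Finset.mul_sum,
      ← Finset.mul_sum, Finset.sum_const, Finset.card_univ, Fintype.card_fin, nsmul_eq_mul]
    field_simp
    rfl
  have hscalar := round_scalar_le hm1 hmn1 hγ hK1 hL hγL (sq_nonneg γu) hγum hγvm
    (integral_nonneg fun ω => by positivity)
    (Finset.sum_nonneg fun i _ => integral_nonneg fun ω => by positivity) hA hw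
  rw [hexpU, hexpV]
  have e : 128 * L ^ 2 * K * ((K : ℝ) - 1) * b ^ 2 / ηu ^ 2 * γ ^ 2
      = 128 * L ^ 2 * K * ((K : ℝ) - 1) * b ^ 2 * γu ^ 2 := by rw [hγu2]; ring
  rw [e]
  linarith

end Descent

/-! ### Independence structure of the run -/

section Independence

variable {du dv n : ℕ} {Ξ Ω : Type*} [MeasurableSpace Ξ] {mΩ : MeasurableSpace Ω} {P : Measure Ω}
  {D : Fin n → Measure Ξ} {m : ℕ} {S : ℕ → Ω → Finset (Fin n)} {ξ : ℕ → Fin n → ℕ → Ω → Ξ}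

/-- Everything but the sample `p`. -/
@[reducible] def otherSamples (S : ℕ → Ω → Finset (Fin n)) (ξ : ℕ → Fin n → ℕ → Ω → Ξ) (p : ℕ × Fin n × ℕ) :
    MeasurableSpace Ω :=
  (⨆ q ∈ ({p}ᶜ : Set (ℕ × Fin n × ℕ)), MeasurableSpace.comap (ξ q.1 q.2.1 q.2.2) inferInstance) ⊔
    MeasurableSpace.comap (fun ω t => S t ω) inferInstance

/-- Everything but the client set of round `t`. -/
@[reducible] def otherClients (S : ℕ → Ω → Finset (Fin n)) (ξ : ℕ → Fin n → ℕ → Ω → Ξ) (t : ℕ) :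
    MeasurableSpace Ω :=
  (⨆ s ∈ ({t}ᶜ : Set ℕ), MeasurableSpace.comap (S s) inferInstance) ⊔
    MeasurableSpace.comap (fun ω (p : ℕ × Fin n × ℕ) => ξ p.1 p.2.1 p.2.2 ω) inferInstance

theorem comap_eval_le {ι : Type*} {α : Type*} [MeasurableSpace α] (f : ι → Ω → α) (i : ι) :
    MeasurableSpace.comap (f i) inferInstance
      ≤ MeasurableSpace.comap (fun ω j => f j ω) inferInstance := by
  have : Measurable[MeasurableSpace.comap (fun ω j => f j ω) inferInstance] (f i) :=
    (measurable_pi_apply i).comp (comap_measurable fun ω j => f j ω)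
  exact this.comap_le

theorem measurable_otherSamples_sample {p q : ℕ × Fin n × ℕ} (h : q ≠ p) :
    Measurable[otherSamples S ξ p] (ξ q.1 q.2.1 q.2.2) :=
  measurable_iff_comap_le.2 ((le_iSup₂_of_le (f := fun q (_ : q ∈ ({p}ᶜ : Set (ℕ × Fin n × ℕ))) =>
    MeasurableSpace.comap (ξ q.1 q.2.1 q.2.2) inferInstance) q h le_rfl).trans le_sup_left)

theorem measurable_otherSamples_clients (p : ℕ × Fin n × ℕ) (t : ℕ) :
    Measurable[otherSamples S ξ p] (S t) :=
  measurable_iff_comap_le.2 ((comap_eval_le S t).trans le_sup_right)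

theorem measurable_otherClients_sample (t : ℕ) (q : ℕ × Fin n × ℕ) :
    Measurable[otherClients S ξ t] (ξ q.1 q.2.1 q.2.2) :=
  measurable_iff_comap_le.2 ((comap_eval_le
    (fun (p : ℕ × Fin n × ℕ) => ξ p.1 p.2.1 p.2.2) q).trans le_sup_right)

theorem measurable_otherClients_clients {t s : ℕ} (h : s ≠ t) :
    Measurable[otherClients S ξ t] (S s) :=
  measurable_iff_comap_le.2 ((le_iSup₂_of_le (f := fun s (_ : s ∈ ({t}ᶜ : Set ℕ)) =>
    MeasurableSpace.comap (S s) inferInstance) s h le_rfl).trans le_sup_left)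

namespace Randomness

theorem otherSamples_le (h : Randomness P D m S ξ) (p : ℕ × Fin n × ℕ) :
    otherSamples S ξ p ≤ mΩ :=
  sup_le (iSup₂_le fun _ _ => (h.measurable_sample _ _ _).comap_le)
    (measurable_pi_lambda _ h.measurable_clients).comap_le

theorem otherClients_le (h : Randomness P D m S ξ) (t : ℕ) : otherClients S ξ t ≤ mΩ :=
  sup_le (iSup₂_le fun _ _ => (h.measurable_clients _).comap_le)
    (measurable_pi_lambda _ fun _ => h.measurable_sample _ _ _).comap_le

variable [IsProbabilityMeasure P]

theorem indep_otherSamples (h : Randomness P D m S ξ) (p : ℕ × Fin n × ℕ) :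
    Indep (otherSamples S ξ p)
      (MeasurableSpace.comap (ξ p.1 p.2.1 p.2.2) inferInstance) P := by
  have hle : ∀ q : ℕ × Fin n × ℕ,
      MeasurableSpace.comap (ξ q.1 q.2.1 q.2.2) inferInstance ≤ mΩ := fun q =>
    (h.measurable_sample _ _ _).comap_le
  have h13 := indep_iSup_of_disjoint hle h.indep_samples.iIndep
    (S := {p}ᶜ) (T := {p}) disjoint_compl_left
  rw [iSup_singleton] at h13
  refine indep_sup_of_indep_sup (iSup₂_le fun q _ => hle q)
    (measurable_pi_lambda _ h.measurable_clients).comap_le (hle p) h13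
    (indep_of_indep_of_le_left ((IndepFun_iff_Indep _ _ _).1 h.indep_samples_clients) ?_)
  have hev := comap_eval_le (fun (q : ℕ × Fin n × ℕ) => ξ q.1 q.2.1 q.2.2)
  exact sup_le (iSup₂_le fun q _ => hev q) (hev p)

theorem indep_otherClients (h : Randomness P D m S ξ) (t : ℕ) :
    Indep (otherClients S ξ t) (MeasurableSpace.comap (S t) inferInstance) P := by
  have hle : ∀ s, MeasurableSpace.comap (S s) inferInstance ≤ mΩ := fun s =>
    (h.measurable_clients s).comap_le
  have h13 := indep_iSup_of_disjoint hle h.indep_clients.iIndep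
    (S := {t}ᶜ) (T := {t}) disjoint_compl_left
  rw [iSup_singleton] at h13
  refine indep_sup_of_indep_sup (iSup₂_le fun s _ => hle s)
    (measurable_pi_lambda _ fun _ => h.measurable_sample _ _ _).comap_le (hle t) h13
    (indep_of_indep_of_le_left ((IndepFun_iff_Indep _ _ _).1 h.indep_samples_clients).symm ?_)
  exact sup_le (iSup₂_le fun s _ => comap_eval_le S s) (comap_eval_le S t)

end Randomness

end Independence

/-! ### The iterates are adapted -/

section Iterates

variable {du dv n : ℕ} {Ξ Ω : Type*} [MeasurableSpace Ξ] {F : Vec du → Vec dv → Ξ → ℝ}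
  {γu γv ηu ηv : ℝ} {m K : ℕ} {u₀ : Vec du} {v₀ : Fin n → Vec dv}
  {S : ℕ → Ω → Finset (Fin n)} {ξ : ℕ → Fin n → ℕ → Ω → Ξ}

theorem measurable_iter [MeasurableSpace Ω]
    (hFu : Measurable fun p : (Vec du × Vec dv) × Ξ => stochGradU F p.1.1 p.1.2 p.2)
    (hFv : Measurable fun p : (Vec du × Vec dv) × Ξ => stochGradV F p.1.1 p.1.2 p.2)
    (t : ℕ) (hS : ∀ s < t, Measurable (S s)) (hξ : ∀ s < t, ∀ i k, Measurable (ξ s i k)) :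
    Measurable fun ω => iter F γu γv ηu ηv m K u₀ v₀ (fun s => S s ω)
      (fun s i k => ξ s i k ω) t := by
  induction t with
  | zero => exact measurable_const
  | succ t ih =>
    exact measurable_fedRound hFu hFv (hS t t.lt_succ_self) (hξ t t.lt_succ_self)
      (ih (fun s hs => hS s (hs.trans t.lt_succ_self)) fun s hs => hξ s (hs.trans t.lt_succ_self))

variable {mΩ : MeasurableSpace Ω} {P : Measure Ω} [IsProbabilityMeasure P] {D : Fin n → Measure Ξ}

/-- The state at round `t` uses only samples and client draws of rounds before `t`, so no sample of
round `t` enters it. Within the round, a local point uses only its own client's samples from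
strictly earlier steps. Both are thus measurable for the σ-algebra that omits the current sample. -/
theorem Randomness.adapted (h : Randomness P D m S ξ)
    (hFu : Measurable fun p : (Vec du × Vec dv) × Ξ => stochGradU F p.1.1 p.1.2 p.2)
    (hFv : Measurable fun p : (Vec du × Vec dv) × Ξ => stochGradV F p.1.1 p.1.2 p.2) (t : ℕ) :
    Adapted P D (ξ t) (localPt F γu γv (ξ t) fun ω => iter F γu γv ηu ηv m K u₀ v₀
      (fun s => S s ω) (fun s i k => ξ s i k ω) t) fun i k => otherSamples S ξ (t, i, k) where
  le i k := h.otherSamples_le (t, i, k)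
  indep i k := h.indep_otherSamples (t, i, k)
  measurable_sample := h.measurable_sample t
  law := h.law_sample t
  measurable_other i k j l hjl :=
    measurable_otherSamples_sample (q := (t, j, l)) fun e => by
      simp only [Prod.mk.injEq, true_and] at e
      exact hjl e.1 e.2
  measurable_point i k j l hjl :=
    @measurable_localPt du dv n Ξ Ω F γu γv _ _ _ (otherSamples S ξ (t, i, k)) hFu hFv
      (@measurable_iter du dv n Ξ Ω _ F γu γv ηu ηv m K u₀ v₀ S ξ (otherSamples S ξ (t, i, k))
        hFu hFv t (fun s _ => measurable_otherSamples_clients _ s) fun s hs j' l' =>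
          measurable_otherSamples_sample (q := (s, j', l')) fun e => hs.ne (congrArg Prod.fst e))
      j l fun l' hl' => measurable_otherSamples_sample (q := (t, j, l')) fun e => by
        simp only [Prod.mk.injEq, true_and] at e
        exact absurd (hl'.trans_le (hjl e.1)) (by omega)

end Iterates

end FedAvgP

namespace FedAvgP

/-! ### Telescoping -/

section Convergence

variable {du dv n : ℕ} {Ξ : Type*} [MeasurableSpace Ξ] {F : Vec du → Vec dv → Ξ → ℝ}
  {D : Fin n → Measure Ξ}

theorem RegularLoss.measurable_stochGradU (hF : RegularLoss F D) :
    Measurable fun p : (Vec du × Vec dv) × Ξ => stochGradU F p.1.1 p.1.2 p.2 :=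
  hF.measurable_gradU.comp
    (measurable_fst.fst.prodMk (measurable_fst.snd.prodMk measurable_snd))

theorem RegularLoss.measurable_stochGradV (hF : RegularLoss F D) :
    Measurable fun p : (Vec du × Vec dv) × Ξ => stochGradV F p.1.1 p.1.2 p.2 :=
  hF.measurable_gradV.comp
    (measurable_fst.fst.prodMk (measurable_fst.snd.prodMk measurable_snd))

/-- Telescoping of a one-round decrease. -/
theorem average_le_of_descent {φ G : ℕ → ℝ} {T : ℕ} {a C φ₀ : ℝ} (hT : 1 ≤ T) (ha : 0 < a)
    (hdesc : ∀ t, φ (t + 1) ≤ φ t - a / 4 * G t + a / 4 * C) (hφ : φ₀ ≤ φ T) :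
    1 / (T : ℝ) * ∑ t ∈ Finset.range T, G t ≤ 4 * (φ 0 - φ₀) / (T * a) + C := by
  have hT0 : (0 : ℝ) < T := by exact_mod_cast hT
  have hsum : ∀ N : ℕ, a / 4 * ∑ t ∈ Finset.range N, G t ≤ φ 0 - φ N + N * (a / 4 * C) := by
    intro N
    induction N with
    | zero => simp
    | succ N ih =>
      rw [Finset.sum_range_succ]
      push_cast
      linarith [hdesc N]
  have h := (hsum T).trans (add_le_add_left (sub_le_sub_left hφ (φ 0)) _)
  have e : 4 * (φ 0 - φ₀) / (T * a) + C
      = 4 / (T * a) * (φ 0 - φ₀ + T * (a / 4 * C)) := by field_simp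
  have e' : 1 / (T : ℝ) * ∑ t ∈ Finset.range T, G t
      = 4 / (T * a) * (a / 4 * ∑ t ∈ Finset.range T, G t) := by field_simp
  rw [e, e']
  exact mul_le_mul_of_nonneg_left h (by positivity)

end Convergence

end FedAvgP

/-! ### Convergence of FedAvg-P -/

theorem mainTheorem1
    {du dv n m K T : ℕ} (hm : 1 ≤ m) (hmn : m ≤ n) (hK : 1 ≤ K) (hT : 1 ≤ T)
    {Ξ Ω : Type*} [MeasurableSpace Ξ] [MeasurableSpace Ω]
    -- the problem
    (F : Vec du → Vec dv → Ξ → ℝ) (D : Fin n → Measure Ξ) [∀ i, IsProbabilityMeasure (D i)]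
    (hF : RegularLoss F D)
    (hbdd : BddBelow (Set.range
      fun p : Vec du × (Fin n → Vec dv) => globalObj F D p.1 p.2))
    -- smoothness, stochastic gradients, gradient dissimilarity
    (Lu Lv Luv Lvu L : ℝ≥0) (hL : L = max (max Lu Lv) (max Luv Lvu))
    (hsmooth : Smooth F D Lu Lv Luv Lvu)
    (σu σv : ℝ) (hσu : 0 ≤ σu) (hσv : 0 ≤ σv) (hstoch : StochasticGradient F D σu σv)
    (b : ℝ) (hb : 0 ≤ b) (hbgd : BoundedDissimilarity F D b)
    -- step sizes; the bound on `γ` is `γ ≤ 1 / (32 L K)`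
    (γ γu γv ηu ηv : ℝ) (hγ : 0 < γ) (hγu : γu * ηu = γ) (hγv : γv * ηv = γ)
    (hηu : Real.sqrt m ≤ ηu) (hηv : Real.sqrt ((n : ℝ) / m) ≤ ηv)
    (hγL : 32 * (L : ℝ) * K * γ ≤ 1)
    -- the run of the algorithm
    (P : Measure Ω) [IsProbabilityMeasure P]
    (S : ℕ → Ω → Finset (Fin n)) (ξ : ℕ → Fin n → ℕ → Ω → Ξ)
    (hrand : Randomness P D m S ξ)
    (u₀ : Vec du) (v₀ : Fin n → Vec dv)
    (x : ℕ → Ω → Vec du × (Fin n → Vec dv))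
    (hx : ∀ t ω, x t ω =
      iter F γu γv ηu ηv m K u₀ v₀ (fun s => S s ω) (fun s i k => ξ s i k ω) t) :
    (∀ t < T,
      Integrable (fun ω => ‖globalGradU F D (x t ω).1 (x t ω).2‖ ^ 2) P ∧
      ∀ i, Integrable (fun ω => ‖gradV (clientObj F D i) (x t ω).1 ((x t ω).2 i)‖ ^ 2) P) ∧
    (1 / (T : ℝ)) * ∑ t ∈ Finset.range T, (expGradU F D P (x t) + expGradV F D P m (x t))
      ≤ 4 * initialGap F D u₀ v₀ / (T * K * γ)
        + 12 * L * (4 * ((n : ℝ) - m) * K * b ^ 2 / (m * n) + σu ^ 2 / m + m * σv ^ 2 / n) * γ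
        + 128 * (L : ℝ) ^ 2 * K * ((K : ℝ) - 1) * b ^ 2 / ηu ^ 2 * γ ^ 2 := by
  have hn : 1 ≤ n := hm.trans hmn
  have hFu := hF.measurable_stochGradU
  have hFv := hF.measurable_stochGradV
  have hsm : ∀ i, BlockSmooth (clientObj F D i) L := fun i => hL ▸ hsmooth.blockSmooth i
  have hou : ∀ i, Oracle (stochGradU F) (gradU (clientObj F D i)) (D i) L σu := fun i =>
    ⟨hFu, (hsm i).gradU_le, hstoch.integrable_u i, hstoch.unbiased_u i, hstoch.integrable_sq_u i,
      hstoch.variance_u i⟩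
  have hov : ∀ i, Oracle (stochGradV F) (gradV (clientObj F D i)) (D i) L σv := fun i =>
    ⟨hFv, (hsm i).gradV_le, hstoch.integrable_v i, hstoch.unbiased_v i, hstoch.integrable_sq_v i,
      hstoch.variance_v i⟩
  obtain rfl : x = fun t ω =>
      iter F γu γv ηu ηv m K u₀ v₀ (fun s => S s ω) (fun s i k => ξ s i k ω) t :=
    funext fun t => funext fun ω => hx t ω
  set x : ℕ → Ω → Vec du × (Fin n → Vec dv) := fun t ω =>
    iter F γu γv ηu ηv m K u₀ v₀ (fun s => S s ω) (fun s i k => ξ s i k ω) t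
  -- Only draws of rounds before `t` enter `x t`, so it is independent of `S t`.
  have hmeas : ∀ t, Measurable[otherClients S ξ t] (x t) := fun t =>
    @measurable_iter du dv n Ξ Ω _ F γu γv ηu ηv m K u₀ v₀ S ξ (otherClients S ξ t) hFu hFv t
      (fun s hs => measurable_otherClients_clients hs.ne)
      fun s _ i k => measurable_otherClients_sample t (s, i, k)
  -- Finite second moments are the only part of the model that depends on the past; the induction
  -- starts from the deterministic initial state.
  have hmodel : ∀ t, RoundModel P F D L σu σv γu γv (ξ t) (x t)
      fun i k => otherSamples S ξ (t, i, k) := by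
    intro t
    induction t with
    | zero => exact ⟨hsm, hou, hov, hrand.adapted hFu hFv 0, memLp_const u₀,
        fun i => memLp_const (v₀ i)⟩
    | succ t ih =>
      obtain ⟨h1, h2⟩ := ih.memLp_next (ηu := ηu) (ηv := ηv) (K := K) hn hmn
        (hrand.measurable_clients t) (hrand.otherClients_le t) (hrand.indep_otherClients t)
        (hrand.uniform_clients t) (hmeas t)
        fun i k => measurable_otherClients_sample t (t, i, k)
      exact ⟨hsm, hou, hov, hrand.adapted hFu hFv (t + 1), h1, h2⟩
  have hgrad := globalGradU_eq (F := F) (D := D) hsmooth.differentiable_u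
  refine ⟨fun t _ => ⟨?_, fun i => ?_⟩, ?_⟩
  · simp only [hgrad]
    exact (hmodel t).memLp_mean_gradU.integrable_norm_pow two_ne_zero
  · exact ((hmodel t).memLp_gradV_start i).integrable_norm_pow two_ne_zero
  · have hKγ : (0 : ℝ) < γ * K := mul_pos hγ (by exact_mod_cast hK)
    -- The telescoped sum ends with the expected objective after `T` rounds, which boundedness below
    -- compares with the infimum.
    have hlower : ⨅ p : Vec du × (Fin n → Vec dv), globalObj F D p.1 p.2
        ≤ ∫ ω, globalObj F D (x T ω).1 (x T ω).2 ∂P := by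
      have h := integral_mono (integrable_const (μ := P)
        (⨅ p : Vec du × (Fin n → Vec dv), globalObj F D p.1 p.2))
        (integrable_globalObj hsm (hmodel T).memLp_u (hmodel T).memLp_v)
        fun ω => ciInf_le hbdd (x T ω)
      rwa [integral_const, probReal_univ, one_smul] at h
    have hstart : ∫ ω, globalObj F D (x 0 ω).1 (x 0 ω).2 ∂P = globalObj F D u₀ v₀ := by
      simp [x, iter]
    have h := average_le_of_descent (φ := fun t => ∫ ω, globalObj F D (x t ω).1 (x t ω).2 ∂P)
      (G := fun t => expGradU F D P (x t) + expGradV F D P m (x t)) hT hKγ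
      (fun t => (hmodel t).descent hm hmn hK hγ hγL hγu hγv hηu hηv hbgd
        (hrand.measurable_clients t) (hrand.otherClients_le t) (hrand.indep_otherClients t)
        (hrand.uniform_clients t) (hmeas t)
        fun i k => measurable_otherClients_sample t (t, i, k)) hlower
    simp only [hstart] at h
    refine h.trans_eq ?_
    rw [initialGap]
    ring
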